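/- Let $d \ge 1$, let $\|\cdot\|$ be an arbitrary norm on $\mathbb{R}^d$, let $\lambda$ be Lebesgue measure on $\mathbb{R}^d$, and let $0 < r < \infty$. Let $P$ be a Borel probability measure on $\mathbb{R}^d$ that is absolutely continuous with respect to $\lambda$ and satisfies $\int \|x\|^{r+\delta}\,dP(x) < \infty$ for some $\delta > 0$. For a set $\alpha \subset \mathbb{R}^d$ let $d(x,\alpha) = \inf_{b \in \alpha}\|x-b\|$ (with $d(x,\emptyset)=\infty$). For $n \ge 1$, a set $\alpha_n$ with $\operatorname{card}(\alpha_n) \le n$ is called $n$-optimal if $\int d(x,\alpha_n)^r\,dP(x) = \inf\{\int d(x,\alpha)^r\,dP(x) : \alpha \subset \mathbb{R}^d,\ \operatorname{card}(\alpha) \le n\}$. For $a \in \alpha$ put $$W(a\,|\,\alpha) = \{x : \|x-a\| = d(x,\alpha)\}, \qquad W_0(a\,|\,\alpha) = \{x : \|x-a\| < d(x,\alpha\setminus\{a\})\}.$$ Then there are constants $c_1,c_2,c_3,c_4 \in (0,\infty)$, depending only on $d$, $\|\cdot\|$, $r$ and $P$, such that the following holds for every density $h : \mathbb{R}^d \to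 [0,\infty)$ of $P$ with respect to $\lambda$ and every sequence $(\alpha_n)_{n\ge1}$ of $n$-optimal sets $\alpha_n$ for $P$. Let $x$ be in the interior of $\operatorname{supp}(P)$, let $h$ be continuous at $x$ with $h(x) > 0$, and for each $n \ge 1$ let $a_{n,x} \in \alpha_n$ satisfy $x \in W(a_{n,x}\,|\,\alpha_n)$. Then $$c_1\,h(x)^{\frac{r}{r+d}} \le \liminf_{n\to\infty} n\,P(W_0(a_{n,x}\,|\,\alpha_n)) \le \limsup_{n\to\infty} n\,P(W(a_{n,x}\,|\,\alpha_n)) \le c_2\,h(x)^{\frac{r}{r+d}}$$ and $$c_3 \le \liminf_{n\to\infty} n^{1+\frac rd}\int_{W(a_{n,x}|\alpha_n)}\|y-a_{n,x}\|^r\,dP(y) \le \limsup_{n\to\infty} n^{1+\frac rd}\int_{W(a_{n,x}|\alpha_n)}\|y-a_{n,x}\|^r\,dP(y) \le c_4 .$$ -/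

import Mathlib

open MeasureTheory Filter
open scoped ENNReal NNReal

noncomputable section

/-- The `r`-th power mean distance `∫ d(x, α)^r dP(x)` of a codebook `α`. The distance to the empty
set is `∞`. -/
def distortion {E : Type*} [PseudoEMetricSpace E] [MeasurableSpace E]
    (P : Measure E) (r : ℝ) (α : Set E) : ℝ≥0∞ :=
  ∫⁻ x, Metric.infEDist x α ^ r ∂P

/-- The `r`-th power `e_{n,r}^r(P)` of the `n`-th level quantization error: the infimum of
`∫ d(x, α)^r dP(x)` over all sets `α` with at most `n` points. -/
def quantErrorPow {E : Type*} [PseudoEMetricSpace E] [MeasurableSpace E]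
    (P : Measure E) (r : ℝ) (n : ℕ) : ℝ≥0∞ :=
  ⨅ (α : Set E) (_ : α.encard ≤ n), distortion P r α

/-- `α` is an `n`-optimal codebook of order `r` for `P`. -/
def IsOptimalCodebook {E : Type*} [PseudoEMetricSpace E] [MeasurableSpace E]
    (P : Measure E) (r : ℝ) (n : ℕ) (α : Set E) : Prop :=
  α.encard ≤ n ∧ distortion P r α = quantErrorPow P r n

/-- The closed Voronoi cell `W(a | α) = {x : ‖x - a‖ = d(x, α)}`. -/
def voronoiCell {E : Type*} [PseudoEMetricSpace E] (a : E) (α : Set E) : Set E :=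
  {x | edist x a = Metric.infEDist x α}

/-- The open Voronoi cell `W₀(a | α) = {x : ‖x - a‖ < d(x, α \ {a})}`. -/
def openVoronoiCell {E : Type*} [PseudoEMetricSpace E] (a : E) (α : Set E) : Set E :=
  {x | edist x a < Metric.infEDist x (α \ {a})}

/-- The local inertia `∫_{W(a | α)} ‖y - a‖^r dP(y)` of the cell of `a`. -/
def localInertia {E : Type*} [PseudoEMetricSpace E] [MeasurableSpace E]
    (P : Measure E) (r : ℝ) (a : E) (α : Set E) : ℝ≥0∞ :=
  ∫⁻ y in voronoiCell a α, edist y a ^ r ∂P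

end

/-! Write `V n` for `quantErrorPow P r n` and `s = n ^ (-1/d)`. The key fact is that, along optimal
codebooks, the increments `V n - V (n+1)` have exact order `s ^ (r+d) = n ^ (-(1+r/d))`.

Upper bound (`exists_quantErrorPow_le_succ_add`): by Pierce's lemma `V n = O(s ^ r)`, and a positive
proportion of the codebook lies in a fixed ball. Packing shows that many of these points have a
neighbour at distance `O(s)`. Removing such a point changes the distance only on its open cell; open
cells are disjoint, so the costs add up to `O(s ^ r)` and some removal costs `O(s ^ r / n)`. Lower
bound (`exists_quantErrorPow_succ_add_le`): `n` balls of radius a small multiple of `s` cannot cover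
a set on which `P` has lower density bounded below; adding an uncovered point of that set gains a
multiple of `s ^ (r+d)`.

Near `x`, `P` is comparable to `h x` times `lam`. A hole of radius `ρ` in the codebook would allow a
gain of order `h x * ρ ^ (r+d)`, so the upper increment bound forces `ρ` to be at most of order `h x
^ (-1/(r+d)) * s`. Hence the cell lies in a ball of that radius about its centre, which bounds its
mass and inertia above. The centre also has a neighbour within `3ρ`, so its removal costs at most
`(4ρ) ^ r * P (openVoronoiCell a α)`; the lower increment bound then bounds this mass below. A small
ball about the centre holds at most half of the guaranteed mass, which bounds the inertia below. -/

lemma encard_sdiff_singleton_le {E : Type*} {a : E} {α : Set E} (ha : a ∈ α) {n : ℕ}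
    (hα : α.encard ≤ ((n + 1 : ℕ) : ℕ∞)) : (α \ {a}).encard ≤ n := by
  have h := Set.encard_sdiff_singleton_add_one ha
  rw [← h] at hα
  push_cast at hα
  exact (ENat.add_le_add_iff_right ENat.one_ne_top).1 hα

/-! ### Open and closed Voronoi cells -/

section Cells

variable {E : Type*} [PseudoMetricSpace E]

/-- Off its open cell, `a` is no closer than the rest of the codebook, so it does not affect the
infimum. -/
lemma infEDist_sdiff_of_notMem_openVoronoiCell {a x : E} {α : Set E} (ha : a ∈ α)
    (hx : x ∉ openVoronoiCell a α) : Metric.infEDist x (α \ {a}) = Metric.infEDist x α := by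
  refine le_antisymm ?_ (Metric.infEDist_anti Set.sdiff_subset)
  have h : α = {a} ∪ α \ {a} := by simp [Set.insert_eq_of_mem ha]
  conv_rhs => rw [h]
  rw [Metric.infEDist_union, Metric.infEDist_singleton]
  exact le_inf (not_lt.1 hx) le_rfl

lemma openVoronoiCell_subset_voronoiCell {a : E} {α : Set E} (ha : a ∈ α) :
    openVoronoiCell a α ⊆ voronoiCell a α := by
  intro x hx
  have h : α = {a} ∪ α \ {a} := by simp [Set.insert_eq_of_mem ha]
  change edist x a = Metric.infEDist x α
  conv_rhs => rw [h]
  rw [Metric.infEDist_union, Metric.infEDist_singleton]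
  exact (inf_eq_left.2 (le_of_lt hx)).symm

/-- A common point would be strictly closer to each of the two centres than to the other. This
disjointness lets removal costs be summed. -/
lemma pairwiseDisjoint_openVoronoiCell (α : Set E) :
    α.PairwiseDisjoint fun a => openVoronoiCell a α := by
  intro a ha b hb hab
  refine Set.disjoint_left.2 fun x hxa hxb => ?_
  have h1 : edist x a < edist x b :=
    lt_of_lt_of_le hxa (Metric.infEDist_le_edist_of_mem ⟨hb, fun h => hab h.symm⟩)
  have h2 : edist x b < edist x a :=
    lt_of_lt_of_le hxb (Metric.infEDist_le_edist_of_mem ⟨ha, hab⟩)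
  exact lt_asymm h1 h2

end Cells

/-! ### Effect of adding or removing one point -/

section Codebook

variable {E : Type*} [PseudoMetricSpace E] [MeasurableSpace E]

lemma quantErrorPow_le_distortion (P : Measure E) (r : ℝ) {n : ℕ} {α : Set E}
    (hα : α.encard ≤ n) : quantErrorPow P r n ≤ distortion P r α :=
  iInf₂_le α hα

lemma quantErrorPow_anti (P : Measure E) (r : ℝ) {m n : ℕ} (hmn : m ≤ n) :
    quantErrorPow P r n ≤ quantErrorPow P r m :=
  le_iInf₂ fun _ hα => quantErrorPow_le_distortion P r (hα.trans (by exact_mod_cast hmn))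

lemma measurable_infEDist_rpow [OpensMeasurableSpace E] (r : ℝ) (α : Set E) :
    Measurable fun x => Metric.infEDist x α ^ r :=
  (measurable_infEDist).pow_const r

/-- Adding a point `y` at distance at least `σ` from an optimal codebook reduces the quantization
error by at least a multiple of `σ ^ r * P (closedBall y (σ / 4))`. -/
lemma quantErrorPow_succ_add_le [OpensMeasurableSpace E] {P : Measure E} {r : ℝ} (hr : 0 < r)
    {n : ℕ} {α : Set E} (hα : IsOptimalCodebook P r n α) {y : E} {σ : ℝ} (hσ : 0 < σ)
    (hy : ENNReal.ofReal σ ≤ Metric.infEDist y α) :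
    quantErrorPow P r (n + 1) +
        ENNReal.ofReal (((3 / 4) ^ r - (1 / 4) ^ r) * σ ^ r) * P (Metric.closedBall y (σ / 4))
      ≤ quantErrorPow P r n := by
  -- On `closedBall y (σ / 4)` the new distance is at most `σ / 4` and the old one at least `3σ /
  -- 4`; `c` is the gap between their `r`-th powers.
  set c := ENNReal.ofReal (((3 / 4) ^ r - (1 / 4) ^ r) * σ ^ r) with hc
  have hcard : (insert y α).encard ≤ ((n + 1 : ℕ) : ℕ∞) := by
    refine (Set.encard_insert_le α y).trans ?_
    push_cast
    exact add_le_add_left hα.1 1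
  have hB : MeasurableSet (Metric.closedBall y (σ / 4)) := Metric.isClosed_closedBall.measurableSet
  have hle : (1 / 4 : ℝ) ^ r ≤ (3 / 4) ^ r :=
    Real.rpow_le_rpow (by norm_num) (by norm_num) hr.le
  calc quantErrorPow P r (n + 1) + c * P (Metric.closedBall y (σ / 4))
      ≤ distortion P r (insert y α) + c * P (Metric.closedBall y (σ / 4)) := by
        gcongr
        exact quantErrorPow_le_distortion P r hcard
    _ = ∫⁻ z, (Metric.infEDist z (insert y α) ^ r +
          (Metric.closedBall y (σ / 4)).indicator (fun _ => c) z) ∂P := by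
        rw [lintegral_add_left (measurable_infEDist_rpow r _), lintegral_indicator_const hB,
          distortion]
    _ ≤ ∫⁻ z, Metric.infEDist z α ^ r ∂P := by
        refine lintegral_mono fun z => ?_
        by_cases hz : z ∈ Metric.closedBall y (σ / 4)
        · rw [Set.indicator_of_mem hz]
          have hzy : edist z y ≤ ENNReal.ofReal (σ / 4) := by
            rw [edist_dist]
            exact ENNReal.ofReal_le_ofReal hz
          have h1 : Metric.infEDist z (insert y α) ≤ ENNReal.ofReal (σ / 4) :=
            (Metric.infEDist_le_edist_of_mem (Set.mem_insert y α)).trans hzy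
          have h2 : ENNReal.ofReal (3 / 4 * σ) ≤ Metric.infEDist z α := by
            have h3 : ENNReal.ofReal σ ≤ Metric.infEDist z α + ENNReal.ofReal (σ / 4) := by
              refine hy.trans ((Metric.infEDist_le_infEDist_add_edist (y := z)).trans ?_)
              rw [edist_comm]
              gcongr
            refine ENNReal.le_of_add_le_add_right (a := ENNReal.ofReal (σ / 4))
              ENNReal.ofReal_ne_top (le_trans (le_of_eq ?_) h3)
            rw [← ENNReal.ofReal_add (by positivity) (by positivity)]
            congr 1
            ring
          calc Metric.infEDist z (insert y α) ^ r + c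
              ≤ ENNReal.ofReal (σ / 4) ^ r + c := by gcongr
            _ = ENNReal.ofReal (3 / 4 * σ) ^ r := by
              rw [ENNReal.ofReal_rpow_of_pos (by positivity),
                ENNReal.ofReal_rpow_of_pos (by positivity), hc, ← ENNReal.ofReal_add
                  (by positivity) (mul_nonneg (sub_nonneg.2 hle) (by positivity)),
                Real.mul_rpow (by norm_num) hσ.le, show σ / 4 = 1 / 4 * σ by ring,
                Real.mul_rpow (by norm_num) hσ.le]
              congr 1
              ring
            _ ≤ Metric.infEDist z α ^ r := by gcongr
        · rw [Set.indicator_of_notMem hz, add_zero]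
          gcongr
          exact Set.subset_insert y α
    _ = quantErrorPow P r n := hα.2

lemma measurableSet_openVoronoiCell [OpensMeasurableSpace E] (a : E) (α : Set E) :
    MeasurableSet (openVoronoiCell a α) :=
  (isOpen_lt (continuous_id.edist continuous_const)
    Metric.continuous_infEDist).measurableSet

lemma measurableSet_voronoiCell [OpensMeasurableSpace E] (a : E) (α : Set E) :
    MeasurableSet (voronoiCell a α) :=
  (isClosed_eq (continuous_id.edist continuous_const)
    Metric.continuous_infEDist).measurableSet

/-- Removing the point `a` from a codebook changes the distortion only on the open Voronoi cell of
`a`. -/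
lemma distortion_sdiff_le [OpensMeasurableSpace E] (P : Measure E) (r : ℝ) {a : E} {α : Set E}
    (ha : a ∈ α) :
    distortion P r (α \ {a}) ≤ distortion P r α +
      ∫⁻ x in openVoronoiCell a α, Metric.infEDist x (α \ {a}) ^ r ∂P := by
  have hm := measurableSet_openVoronoiCell a α
  rw [distortion, distortion, ← lintegral_indicator hm,
    ← lintegral_add_left (measurable_infEDist_rpow r α)]
  refine lintegral_mono fun x => ?_
  by_cases hx : x ∈ openVoronoiCell a α
  · rw [Set.indicator_of_mem hx]
    exact le_add_self
  · rw [Set.indicator_of_notMem hx, add_zero, infEDist_sdiff_of_notMem_openVoronoiCell ha hx]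

end Codebook

/-! ### Cells of a locally dense codebook -/

section Geometry

variable {E : Type*} [NormedAddCommGroup E]

variable {α : Set E} {a x : E} {ρ η : ℝ}

lemma dist_lt_of_mem_voronoiCell_center (hη : 0 < η)
    (hU : ∀ y ∈ Metric.ball x η, Metric.infEDist y α < ENNReal.ofReal ρ)
    (hx : x ∈ voronoiCell a α) : dist x a < ρ := by
  have h := hU x (Metric.mem_ball_self hη)
  rw [← (show edist x a = _ from hx), edist_dist] at h
  exact (ENNReal.ofReal_lt_ofReal_iff_of_nonneg dist_nonneg).1 h

variable [NormedSpace ℝ E]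

/-- Voronoi cells are star-shaped with respect to their centre. -/
lemma lineMap_mem_voronoiCell {z : E} (ha : a ∈ α) (hz : z ∈ voronoiCell a α)
    {t : ℝ} (h0 : 0 ≤ t) (h1 : t ≤ 1) : a + t • (z - a) ∈ voronoiCell a α := by
  refine le_antisymm ?_ (Metric.infEDist_le_edist_of_mem ha)
  -- The triangle inequality through `a + t • (z - a)` is an equality for `a`, so a codebook point
  -- closer to it than `a` would also be closer to `z`.
  have hz' : edist z a ≤ edist z (a + t • (z - a)) + Metric.infEDist (a + t • (z - a)) α := by
    rw [show edist z a = Metric.infEDist z α from hz]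
    exact Metric.infEDist_le_edist_add_infEDist
  have e1 : edist (a + t • (z - a)) a = ENNReal.ofReal (t * ‖z - a‖) := by
    rw [edist_dist, dist_eq_norm, add_sub_cancel_left, norm_smul, Real.norm_of_nonneg h0]
  have e2 : edist z (a + t • (z - a)) = ENNReal.ofReal ((1 - t) * ‖z - a‖) := by
    rw [edist_dist, dist_eq_norm, show z - (a + t • (z - a)) = (1 - t) • (z - a) by module,
      norm_smul, Real.norm_of_nonneg (by linarith)]
  rw [e2, edist_dist, dist_eq_norm, show ‖z - a‖ = (1 - t) * ‖z - a‖ + t * ‖z - a‖ by ring,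
    ENNReal.ofReal_add (by nlinarith [norm_nonneg (z - a)]) (by positivity)] at hz'
  rw [e1]
  refine ENNReal.le_of_add_le_add_left (a := ENNReal.ofReal ((1 - t) * ‖z - a‖))
    ENNReal.ofReal_ne_top ?_
  convert hz' using 3
  ring

/-- If every point of a ball around `x` is within `ρ` of the codebook, then the Voronoi cell that
contains `x` has radius at most `ρ`. -/
lemma voronoiCell_subset_closedBall (hρ : 0 < ρ) (hη : 2 * ρ < η)
    (hU : ∀ y ∈ Metric.ball x η, Metric.infEDist y α < ENNReal.ofReal ρ)
    (ha : a ∈ α) (hx : x ∈ voronoiCell a α) :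
    voronoiCell a α ⊆ Metric.closedBall a ρ := by
  intro z hz
  by_contra hza
  rw [Metric.mem_closedBall, not_le, dist_eq_norm] at hza
  have hza0 : 0 < ‖z - a‖ := hρ.trans hza
  -- By star-shapedness the cell contains a point at distance exactly `ρ` from `a`. It is within
  -- `2ρ` of `x`, where the distance to `α` is below `ρ`: a contradiction.
  have hw := lineMap_mem_voronoiCell ha hz (t := ρ / ‖z - a‖) (by positivity)
    ((div_le_one hza0).2 hza.le)
  have hd : dist (a + (ρ / ‖z - a‖) • (z - a)) a = ρ := by
    rw [dist_eq_norm, add_sub_cancel_left, norm_smul, norm_div, norm_norm,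
      div_mul_cancel₀ _ hza0.ne', Real.norm_of_nonneg hρ.le]
  have hxa := dist_lt_of_mem_voronoiCell_center (by linarith) hU hx
  have hball : a + (ρ / ‖z - a‖) • (z - a) ∈ Metric.ball x η := by
    rw [Metric.mem_ball]
    have := dist_triangle (a + (ρ / ‖z - a‖) • (z - a)) a x
    rw [dist_comm a x] at this
    linarith
  have h := hU _ hball
  rw [← (show edist _ a = _ from hw), edist_dist, hd] at h
  exact lt_irrefl _ h

/-- Under the same hypothesis the centre of the cell has another point of the codebook within
`3 * ρ`. -/
lemma infEDist_sdiff_le_of_dense [Nontrivial E] (hρ : 0 < ρ) (hη : 3 * ρ < η)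
    (hU : ∀ y ∈ Metric.ball x η, Metric.infEDist y α < ENNReal.ofReal ρ)
    (hx : x ∈ voronoiCell a α) :
    Metric.infEDist a (α \ {a}) ≤ ENNReal.ofReal (3 * ρ) := by
  -- The codebook point within `ρ` of `a + v` cannot be `a`, which is `2ρ` away.
  obtain ⟨v, hv⟩ := exists_norm_eq E (show (0 : ℝ) ≤ 2 * ρ by positivity)
  have hxa := dist_lt_of_mem_voronoiCell_center (by linarith) hU hx
  have hva : dist (a + v) a = 2 * ρ := by rw [dist_eq_norm, add_sub_cancel_left, hv]
  have hball : a + v ∈ Metric.ball x η := by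
    rw [Metric.mem_ball]
    have := dist_triangle (a + v) a x
    rw [dist_comm a x] at this
    linarith
  obtain ⟨b, hb, hlt⟩ := Metric.infEDist_lt_iff.1 (hU _ hball)
  rw [edist_dist, ENNReal.ofReal_lt_ofReal_iff hρ] at hlt
  have hba : b ≠ a := by
    rintro rfl
    linarith
  refine (Metric.infEDist_le_edist_of_mem (show b ∈ α \ {a} from ⟨hb, hba⟩)).trans ?_
  rw [edist_dist]
  refine ENNReal.ofReal_le_ofReal ?_
  have := dist_triangle a (a + v) b
  rw [dist_comm a (a + v)] at this
  linarith

end Geometry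

/-! ### Packing and moment inequalities -/

lemma ENNReal.add_rpow_le_two_rpow_mul (a b : ℝ≥0∞) {q : ℝ} (hq : 0 ≤ q) :
    (a + b) ^ q ≤ 2 ^ q * (a ^ q + b ^ q) := by
  rcases le_total a b with h | h
  · calc (a + b) ^ q ≤ (2 * b) ^ q := by
          gcongr
          rw [two_mul]
          gcongr
      _ = 2 ^ q * b ^ q := ENNReal.mul_rpow_of_nonneg _ _ hq
      _ ≤ _ := by
          gcongr
          exact le_add_self
  · calc (a + b) ^ q ≤ (2 * a) ^ q := by
          gcongr
          rw [two_mul]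
          gcongr
      _ = 2 ^ q * a ^ q := ENNReal.mul_rpow_of_nonneg _ _ hq
      _ ≤ _ := by
          gcongr
          exact le_self_add

/-- Packing bound: disjoint subsets of `T`, each of measure at least `c`. -/
lemma encard_mul_le_measure {Ω ι : Type*} [MeasurableSpace Ω] (μ : Measure Ω) {u : Set ι}
    {B : ι → Set Ω} (hm : ∀ i, MeasurableSet (B i)) (hd : u.PairwiseDisjoint B) {c : ℝ≥0∞}
    (hc : ∀ i ∈ u, c ≤ μ (B i)) {T : Set Ω} (hT : ∀ i ∈ u, B i ⊆ T) :
    (u.encard : ℝ≥0∞) * c ≤ μ T := by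
  rw [← ENNReal.tsum_set_const]
  calc ∑' _ : u, c ≤ ∑' i : u, μ (B i) := ENNReal.tsum_le_tsum fun i => hc i i.2
    _ ≤ μ (⋃ i : u, B i) := by
        refine tsum_meas_le_meas_iUnion_of_disjoint μ (fun i => hm i) fun i j hij => ?_
        exact hd i.2 j.2 fun h => hij (Subtype.ext h)
    _ ≤ μ T := measure_mono (Set.iUnion_subset fun i => hT i i.2)

lemma lintegral_one_add_norm_rpow_lt_top {E : Type*} [NormedAddCommGroup E]
    [MeasurableSpace E] (P : Measure E) [IsFiniteMeasure P] {q : ℝ} (hq : 0 ≤ q)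
    (h : ∫⁻ x, ‖x‖ₑ ^ q ∂P < ∞) : ∫⁻ x, (1 + ‖x‖ₑ) ^ q ∂P < ∞ := by
  calc ∫⁻ x, (1 + ‖x‖ₑ) ^ q ∂P ≤ ∫⁻ x, 2 ^ q * (1 ^ q + ‖x‖ₑ ^ q) ∂P :=
        lintegral_mono fun x => ENNReal.add_rpow_le_two_rpow_mul _ _ hq
    _ = 2 ^ q * (P Set.univ + ∫⁻ x, ‖x‖ₑ ^ q ∂P) := by
        rw [lintegral_const_mul' _ _ (ENNReal.rpow_ne_top_of_nonneg hq ENNReal.ofNat_ne_top),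
          lintegral_add_left measurable_const]
        simp
    _ < ∞ := by
        refine ENNReal.mul_lt_top ?_ (ENNReal.add_lt_top.2 ⟨measure_lt_top _ _, h⟩)
        exact (ENNReal.rpow_ne_top_of_nonneg hq ENNReal.ofNat_ne_top).lt_top

/-! ### Pierce's lemma -/

section Upper

variable {E : Type*} [NormedAddCommGroup E] [NormedSpace ℝ E] [FiniteDimensional ℝ E]
  [MeasurableSpace E] [BorelSpace E]

/-- There are finite nets whose mesh at `x` is `ε * (1 + ‖x‖) ^ p` and that have `O(ε ^ (-d))`
points, as long as `p > 1`. -/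
lemma exists_weighted_net (lam : Measure E) [lam.IsAddHaarMeasure] {p : ℝ} (hp : 1 < p)
    (hd : 0 < Module.finrank ℝ E) :
    ∃ C : ℝ, 0 < C ∧ ∀ ε : ℝ, 0 < ε → ∃ A : Set E,
      (A.encard : ℝ≥0∞) * ENNReal.ofReal (ε ^ Module.finrank ℝ E) ≤ ENNReal.ofReal C ∧
      ∀ x, Metric.infEDist x (insert 0 A) ≤ ENNReal.ofReal (ε * (1 + ‖x‖) ^ p) := by
  set d := Module.finrank ℝ E with hd_def
  have hd' : (0 : ℝ) < d := by exact_mod_cast hd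
  have hpd : (Module.finrank ℝ E : ℝ) < p * d := by
    rw [← hd_def]
    nlinarith
  -- `μ` is finite because `p * d > d`, and a ball about `a` of radius `κ (1 + ‖a‖) ^ p` has
  -- `μ`-mass at least a multiple of `κ ^ d`, uniformly over `a ∈ S`. Packing in `μ` therefore
  -- counts the net.
  set μ : Measure E :=
    lam.withDensity fun x => ENNReal.ofReal ((1 + ‖x‖) ^ (-(p * d))) with hμ
  have hμfin : μ Set.univ < ∞ := by
    rw [hμ, withDensity_apply _ MeasurableSet.univ, Measure.restrict_univ]
    exact finite_integral_one_add_norm hpd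
  set v := lam (Metric.closedBall 0 1) with hv
  have hv0 : v ≠ 0 := (Metric.measure_closedBall_pos lam 0 one_pos).ne'
  have hv1 : v ≠ ∞ := measure_closedBall_lt_top.ne
  set q : ℝ := (2 : ℝ) ^ (-(p * d)) * ((10 * 2 ^ p)⁻¹) ^ d with hq
  have hq0 : 0 < q := by positivity
  have hqv0 : ENNReal.ofReal q * v ≠ 0 := mul_ne_zero (by simpa using hq0) hv0
  have hqv1 : ENNReal.ofReal q * v ≠ ∞ := ENNReal.mul_ne_top ENNReal.ofReal_ne_top hv1
  refine ⟨(μ Set.univ / (ENNReal.ofReal q * v)).toReal + 1, by positivity, fun ε hε => ?_⟩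
  set κ : ℝ := ε / (10 * 2 ^ p) with hκ
  have hκ0 : 0 < κ := by positivity
  have h2p : (1 : ℝ) ≤ 2 ^ p := Real.one_le_rpow (by norm_num) (by linarith)
  have hκε : κ ≤ ε / 10 := by
    rw [hκ]
    gcongr
    linarith
  -- On `S` the radii are at most a tenth of `1 + ‖a‖`, so this weight varies by a bounded factor on
  -- each ball. Off `S` the origin is already close enough.
  set S : Set E := {a | ε * (1 + ‖a‖) ^ (p - 1) ≤ 1} with hS
  have hrad : ∀ a ∈ S, κ * (1 + ‖a‖) ^ p ≤ (1 + ‖a‖) / 10 := by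
    intro a ha
    have hw : 0 < 1 + ‖a‖ := by positivity
    have h1 : (1 + ‖a‖) ^ p = (1 + ‖a‖) ^ (p - 1) * (1 + ‖a‖) := by
      rw [← Real.rpow_add_one hw.ne']
      congr 1
      ring
    rw [h1]
    have h2 : ε * (1 + ‖a‖) ^ (p - 1) ≤ 1 := ha
    have h3 : κ * (1 + ‖a‖) ^ (p - 1) ≤ 1 / 10 :=
      calc κ * (1 + ‖a‖) ^ (p - 1) ≤ ε / 10 * (1 + ‖a‖) ^ (p - 1) := by gcongr
        _ = ε * (1 + ‖a‖) ^ (p - 1) / 10 := by ring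
        _ ≤ 1 / 10 := by gcongr
    calc κ * ((1 + ‖a‖) ^ (p - 1) * (1 + ‖a‖)) = κ * (1 + ‖a‖) ^ (p - 1) * (1 + ‖a‖) := by ring
      _ ≤ 1 / 10 * (1 + ‖a‖) := by gcongr
      _ = _ := by ring
  have hbdd : ∀ a ∈ S, κ * (1 + ‖a‖) ^ p ≤ (1 / ε) ^ (1 / (p - 1)) / 10 := by
    intro a ha
    refine (hrad a ha).trans ?_
    have h2 : ε * (1 + ‖a‖) ^ (p - 1) ≤ 1 := ha
    have hp1 : 0 < p - 1 := by linarith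
    gcongr
    calc 1 + ‖a‖ = ((1 + ‖a‖) ^ (p - 1)) ^ (1 / (p - 1)) := by
          rw [← Real.rpow_mul (by positivity), mul_one_div_cancel hp1.ne', Real.rpow_one]
      _ ≤ (1 / ε) ^ (1 / (p - 1)) := by
          gcongr
          rw [le_div_iff₀ hε]
          linarith
  -- The enlargement factor 5 and the comparison `1 + ‖b‖ ≤ 2 (1 + ‖x‖)` are absorbed by `κ`: `5 * κ
  -- * 2 ^ p = ε / 2`.
  obtain ⟨A, hAS, hdisj, hcov⟩ :=
    Vitali.exists_disjoint_subfamily_covering_enlargement_closedBall S (fun a : E => a)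
      (fun a => κ * (1 + ‖a‖) ^ p) _ hbdd 5 (by norm_num)
  refine ⟨A, ?_, fun x => ?_⟩
  · have hmeas : ∀ a ∈ A, ENNReal.ofReal (ε ^ d) * (ENNReal.ofReal q * v) ≤
        μ (Metric.closedBall a (κ * (1 + ‖a‖) ^ p)) := by
      intro a ha
      have hw : 0 < 1 + ‖a‖ := by positivity
      have hlow : ∀ y ∈ Metric.closedBall a (κ * (1 + ‖a‖) ^ p),
          ENNReal.ofReal ((2 * (1 + ‖a‖)) ^ (-(p * d))) ≤
            ENNReal.ofReal ((1 + ‖y‖) ^ (-(p * d))) := by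
        intro y hy
        refine ENNReal.ofReal_le_ofReal ?_
        refine Real.rpow_le_rpow_of_nonpos (by positivity) ?_ (by
          have : 0 < p * d := by positivity
          linarith)
        have h1 := hrad a (hAS ha)
        rw [Metric.mem_closedBall, dist_eq_norm] at hy
        have h2 : ‖y‖ ≤ ‖a‖ + ‖y - a‖ := by
          simpa using norm_add_le a (y - a)
        linarith [norm_nonneg a]
      calc ENNReal.ofReal (ε ^ d) * (ENNReal.ofReal q * v)
          = ENNReal.ofReal ((2 * (1 + ‖a‖)) ^ (-(p * d))) *
              lam (Metric.closedBall a (κ * (1 + ‖a‖) ^ p)) := by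
            rw [Measure.addHaar_closedBall' lam a (by positivity), ← mul_assoc, ← mul_assoc,
              ← ENNReal.ofReal_mul (by positivity), ← ENNReal.ofReal_mul (by positivity)]
            congr 2
            have e1 : ((1 + ‖a‖) ^ p) ^ d = (1 + ‖a‖) ^ (p * d) := by
              rw [Real.rpow_mul hw.le, Real.rpow_natCast]
            have e2 : (1 + ‖a‖) ^ (-(p * d)) * (1 + ‖a‖) ^ (p * d) = 1 := by
              rw [← Real.rpow_add hw]
              simp
            rw [Real.mul_rpow (by norm_num) hw.le, mul_pow, e1, hq, hκ, div_eq_mul_inv, mul_pow]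
            linear_combination (-(2 : ℝ) ^ (-(p * d)) * ε ^ d * ((10 * 2 ^ p)⁻¹) ^ d) * e2
        _ = ∫⁻ y in Metric.closedBall a (κ * (1 + ‖a‖) ^ p),
              ENNReal.ofReal ((2 * (1 + ‖a‖)) ^ (-(p * d))) ∂lam := by
            rw [setLIntegral_const]
        _ ≤ μ (Metric.closedBall a (κ * (1 + ‖a‖) ^ p)) := by
            rw [hμ, withDensity_apply _ Metric.isClosed_closedBall.measurableSet]
            exact setLIntegral_mono' Metric.isClosed_closedBall.measurableSet hlow
    have hpack := encard_mul_le_measure μ (fun a => Metric.isClosed_closedBall.measurableSet)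
      hdisj hmeas (fun a _ => Set.subset_univ _)
    rw [← mul_assoc] at hpack
    have hfin : μ Set.univ / (ENNReal.ofReal q * v) ≠ ∞ := ENNReal.div_ne_top hμfin.ne hqv0
    calc (A.encard : ℝ≥0∞) * ENNReal.ofReal (ε ^ d) ≤ μ Set.univ / (ENNReal.ofReal q * v) :=
          (ENNReal.le_div_iff_mul_le (Or.inl hqv0) (Or.inl hqv1)).2 hpack
      _ = ENNReal.ofReal (μ Set.univ / (ENNReal.ofReal q * v)).toReal :=
          (ENNReal.ofReal_toReal hfin).symm
      _ ≤ _ := ENNReal.ofReal_le_ofReal (by linarith)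
  · have hw : 0 < 1 + ‖x‖ := by positivity
    by_cases hx : x ∈ S
    · obtain ⟨b, hb, hsub⟩ := hcov x hx
      have hxb : dist x b ≤ 5 * (κ * (1 + ‖b‖) ^ p) :=
        hsub (Metric.mem_closedBall_self (by positivity))
      have hb2 : 1 + ‖b‖ ≤ 2 * (1 + ‖x‖) := by
        have h1 := hrad b (hAS hb)
        have h2 : ‖b‖ ≤ ‖x‖ + ‖x - b‖ := by
          have := norm_sub_le x (x - b)
          simpa using this
        rw [dist_eq_norm] at hxb
        linarith
      refine (Metric.infEDist_le_edist_of_mem (Set.mem_insert_of_mem 0 hb)).trans ?_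
      rw [edist_dist]
      refine ENNReal.ofReal_le_ofReal (hxb.trans ?_)
      calc 5 * (κ * (1 + ‖b‖) ^ p) ≤ 5 * (κ * (2 * (1 + ‖x‖)) ^ p) := by gcongr
        _ = ε * (1 + ‖x‖) ^ p / 2 := by
          rw [Real.mul_rpow (by norm_num) hw.le, hκ]
          field_simp
          norm_num
        _ ≤ ε * (1 + ‖x‖) ^ p := half_le_self (by positivity)
    · refine (Metric.infEDist_le_edist_of_mem (Set.mem_insert 0 A)).trans ?_
      rw [edist_dist, dist_zero_right]
      refine ENNReal.ofReal_le_ofReal ?_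
      have h2 : 1 < ε * (1 + ‖x‖) ^ (p - 1) := not_le.1 hx
      have h1 : (1 + ‖x‖) ^ p = (1 + ‖x‖) ^ (p - 1) * (1 + ‖x‖) := by
        rw [← Real.rpow_add_one hw.ne']
        congr 1
        ring
      rw [h1, ← mul_assoc]
      nlinarith [norm_nonneg x]

/-- Pierce's lemma: the quantization error is `O(n ^ (-r / d))`. Here `s` stands for
`n ^ (-1 / d)`. -/
theorem exists_quantErrorPow_le (lam : Measure E) [lam.IsAddHaarMeasure]
    (hd : 0 < Module.finrank ℝ E) (P : Measure E) [IsFiniteMeasure P] {r : ℝ} (hr : 0 < r)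
    (hmom : ∃ δ : ℝ, 0 < δ ∧ ∫⁻ x, ‖x‖ₑ ^ (r + δ) ∂P < ∞) :
    ∃ C : ℝ, 0 < C ∧ ∀ (n : ℕ) (s : ℝ), 0 < s → n * s ^ Module.finrank ℝ E = 1 →
      quantErrorPow P r n ≤ ENNReal.ofReal (C * s ^ r) := by
  obtain ⟨δ, hδ, hmom⟩ := hmom
  -- With `p = 1 + δ / r`, the `r`-th power of the mesh grows like `(1 + ‖x‖) ^ (r + δ)`, which is
  -- integrable.
  have hp : 1 < 1 + δ / r := by
    have : 0 < δ / r := by positivity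
    linarith
  obtain ⟨C, hC, hnet⟩ := exists_weighted_net lam hp hd
  set d := Module.finrank ℝ E with hd_def
  have hI := lintegral_one_add_norm_rpow_lt_top P (q := r + δ) (by positivity) hmom
  set I := ∫⁻ x, (1 + ‖x‖ₑ) ^ (r + δ) ∂P with hI_def
  -- Since `K ^ d ≥ K > C`, the net of mesh `K * s` has strictly fewer than `n` points, leaving room
  -- for the origin.
  set K : ℝ := 2 * C + 1 with hK
  have hK1 : 1 ≤ K := by linarith
  have hK0 : 0 < K := by linarith
  refine ⟨K ^ r * (I.toReal + 1), by positivity, fun n s hs hns => ?_⟩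
  obtain ⟨A, hA, hdist⟩ := hnet (K * s) (by positivity)
  have hcard : (insert 0 A).encard ≤ n := by
    have hlt : (A.encard : ℝ≥0∞) < n := by
      by_contra! hle
      have h1 : ENNReal.ofReal K ≤ ENNReal.ofReal C :=
        calc ENNReal.ofReal K ≤ ENNReal.ofReal (n * (K * s) ^ d) := by
              refine ENNReal.ofReal_le_ofReal ?_
              rw [mul_pow, mul_left_comm, hns, mul_one]
              exact le_self_pow₀ hK1 hd.ne'
          _ = n * ENNReal.ofReal ((K * s) ^ d) := by
              rw [ENNReal.ofReal_mul (by positivity), ENNReal.ofReal_natCast]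
          _ ≤ A.encard * ENNReal.ofReal ((K * s) ^ d) := by gcongr
          _ ≤ ENNReal.ofReal C := hA
      rw [ENNReal.ofReal_le_ofReal_iff hC.le] at h1
      linarith
    have hlt' : A.encard < n := by
      rw [← ENat.toENNReal_coe] at hlt
      exact ENat.toENNReal_lt.1 hlt
    exact (Set.encard_insert_le A 0).trans (Order.add_one_le_of_lt hlt')
  calc quantErrorPow P r n ≤ distortion P r (insert 0 A) := quantErrorPow_le_distortion P r hcard
    _ ≤ ∫⁻ x, ENNReal.ofReal ((K * s) ^ r) * (1 + ‖x‖ₑ) ^ (r + δ) ∂P := by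
        refine lintegral_mono fun x => ?_
        calc Metric.infEDist x (insert 0 A) ^ r
            ≤ ENNReal.ofReal (K * s * (1 + ‖x‖) ^ (1 + δ / r)) ^ r := by
              gcongr
              exact hdist x
          _ = ENNReal.ofReal ((K * s) ^ r) * (1 + ‖x‖ₑ) ^ (r + δ) := by
              have h1 : (1 : ℝ≥0∞) + ‖x‖ₑ = ENNReal.ofReal (1 + ‖x‖) := by
                rw [ENNReal.ofReal_add zero_le_one (norm_nonneg x), ENNReal.ofReal_one,
                  ofReal_norm]
              rw [h1, ENNReal.ofReal_rpow_of_pos (by positivity),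
                ENNReal.ofReal_rpow_of_pos (by positivity), ← ENNReal.ofReal_mul (by positivity),
                Real.mul_rpow (by positivity) (by positivity), ← Real.rpow_mul (by positivity)]
              congr 3
              field_simp
    _ = ENNReal.ofReal ((K * s) ^ r) * I := by
        rw [lintegral_const_mul' _ _ ENNReal.ofReal_ne_top]
    _ ≤ ENNReal.ofReal ((K * s) ^ r) * ENNReal.ofReal (I.toReal + 1) := by
        gcongr
        rw [← ENNReal.ofReal_toReal hI.ne]
        refine ENNReal.ofReal_le_ofReal ?_
        rw [ENNReal.toReal_ofReal ENNReal.toReal_nonneg]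
        linarith
    _ = ENNReal.ofReal (K ^ r * (I.toReal + 1) * s ^ r) := by
        rw [← ENNReal.ofReal_mul (by positivity), Real.mul_rpow hK0.le hs.le]
        congr 1
        ring

end Upper

/-! ### Upper bound for the increments -/

lemma exists_measure_lt_of_absolutelyContinuous {Ω : Type*} [MeasurableSpace Ω]
    {P lam : Measure Ω} [IsFiniteMeasure P] [SigmaFinite lam] (hP : P ≪ lam) {ε : ℝ≥0∞}
    (hε : ε ≠ 0) : ∃ δ > 0, ∀ A, lam A < δ → P A < ε := by
  have hfin : ∫⁻ x, P.rnDeriv lam x ∂lam ≠ ∞ := (Measure.lintegral_rnDeriv_lt_top P lam).ne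
  obtain ⟨δ, hδ, h⟩ := exists_pos_setLIntegral_lt_of_measure_lt hfin hε
  refine ⟨δ, hδ, fun A hA => ?_⟩
  rw [← Measure.withDensity_rnDeriv_eq P lam hP, withDensity_apply' _ A]
  exact h A hA

lemma exists_half_le_measure_closedBall {E : Type*} [NormedAddCommGroup E] [MeasurableSpace E]
    (P : Measure E) [IsProbabilityMeasure P] :
    ∃ R : ℝ, 0 < R ∧ 1 / 2 ≤ P (Metric.closedBall 0 R) := by
  have hmono : Monotone fun n : ℕ => Metric.closedBall (0 : E) n := fun m n hmn =>
    Metric.closedBall_subset_closedBall (by exact_mod_cast hmn)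
  have h := tendsto_measure_iUnion_atTop (μ := P) hmono
  rw [Metric.iUnion_closedBall_nat, measure_univ] at h
  have h2 : (1 / 2 : ℝ≥0∞) < 1 := by
    rw [one_div]
    exact ENNReal.inv_lt_one.2 ENNReal.one_lt_two
  obtain ⟨n, hn1, hn⟩ := ((eventually_gt_atTop 0).and (h.eventually_const_lt h2)).exists
  exact ⟨n, by exact_mod_cast hn1, hn.le⟩

section Increment

variable {E : Type*} [NormedAddCommGroup E] [NormedSpace ℝ E] [FiniteDimensional ℝ E]
  [MeasurableSpace E] [BorelSpace E]

lemma measure_biUnion_closedBall_le (lam : Measure E) [lam.IsAddHaarMeasure] {α : Set E}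
    (hα : α.Countable) {t : ℝ} (ht : 0 ≤ t) :
    lam (⋃ b ∈ α, Metric.closedBall b t) ≤
      α.encard * (ENNReal.ofReal (t ^ Module.finrank ℝ E) * lam (Metric.closedBall 0 1)) := by
  refine (measure_biUnion_le lam hα _).trans (le_of_eq ?_)
  rw [← ENNReal.tsum_set_const]
  exact tsum_congr fun b => Measure.addHaar_closedBall' lam _ ht

/-- An optimal codebook has a positive proportion of its points in a fixed ball. -/
lemma exists_le_encard_inter_closedBall (lam : Measure E) [lam.IsAddHaarMeasure]
    (hd : 0 < Module.finrank ℝ E) (P : Measure E) [IsProbabilityMeasure P] (hP : P ≪ lam)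
    {r : ℝ} (hr : 0 < r) (hmom : ∃ δ : ℝ, 0 < δ ∧ ∫⁻ x, ‖x‖ₑ ^ (r + δ) ∂P < ∞) :
    ∃ R c s₀ : ℝ, 0 < R ∧ 0 < c ∧ 0 < s₀ ∧ ∀ (n : ℕ) (s : ℝ), 0 < s → s ≤ s₀ →
      n * s ^ Module.finrank ℝ E = 1 → ∀ α : Set E, IsOptimalCodebook P r n α →
      ENNReal.ofReal (c * n) ≤ ((α ∩ Metric.closedBall 0 R).encard : ℝ≥0∞) := by
  obtain ⟨C, hC, hV⟩ := exists_quantErrorPow_le lam hd P hr hmom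
  obtain ⟨R, hR, hPR⟩ := exists_half_le_measure_closedBall P
  obtain ⟨δ, hδ, hδP⟩ := exists_measure_lt_of_absolutelyContinuous hP (ε := 1 / 4) (by simp)
  set d := Module.finrank ℝ E with hd_def
  set v := lam (Metric.closedBall 0 1) with hv
  have hv1 : v ≠ ∞ := measure_closedBall_lt_top.ne
  obtain ⟨q, hq, hqv⟩ := ENNReal.exists_nnreal_pos_mul_lt hv1 hδ.ne'
  -- If a quarter of the mass were at distance at least `T * s`, the error would be at least `(C +
  -- 1/4) * s ^ r`, contradicting Pierce's bound.
  set T : ℝ := (4 * C + 1) ^ (1 / r) with hT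
  have hT0 : 0 < T := by positivity
  have hTr : T ^ r = 4 * C + 1 := by
    rw [hT, ← Real.rpow_mul (by positivity), one_div_mul_cancel hr.ne', Real.rpow_one]
  -- Fewer than `q / T ^ d * n` points in the ball of radius `3R` would have `T * s`-balls of total
  -- volume below `δ`, hence `P`-mass below 1/4. Codebook points outside that ball are at least `2R
  -- ≥ T * s` from the ball of radius `R`, which carries half the mass.
  refine ⟨3 * R, q / T ^ d, R / T, by positivity, by positivity, by positivity,
    fun n s hs hsR hns α hα => ?_⟩
  have hTs : T * s ≤ R := by
    rw [le_div_iff₀ hT0] at hsR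
    linarith
  by_contra! hlt
  set β := α ∩ Metric.closedBall 0 (3 * R) with hβ
  have hαfin : α.Finite := Set.finite_of_encard_le_coe hα.1
  have hU : lam (⋃ b ∈ β, Metric.closedBall b (T * s)) < δ := by
    refine lt_of_le_of_lt ((measure_biUnion_closedBall_le lam
      (hαfin.subset Set.inter_subset_left).countable (by positivity)).trans ?_) hqv
    rw [← mul_assoc]
    refine mul_le_mul_left ?_ v
    calc (β.encard : ℝ≥0∞) * ENNReal.ofReal ((T * s) ^ d)
        ≤ ENNReal.ofReal (q / T ^ d * n) * ENNReal.ofReal ((T * s) ^ d) := by gcongr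
      _ = ENNReal.ofReal q := by
          rw [← ENNReal.ofReal_mul (by positivity), mul_pow]
          congr 1
          field_simp
          linarith
      _ = q := ENNReal.ofReal_coe_nnreal
  have hPU := hδP _ hU
  set U := ⋃ b ∈ β, Metric.closedBall b (T * s) with hU_def
  have hUc : IsClosed U :=
    (hαfin.subset Set.inter_subset_left).isClosed_biUnion fun b _ => Metric.isClosed_closedBall
  have hfar : ∀ x ∈ Metric.closedBall 0 R \ U, ENNReal.ofReal (T * s) ≤ Metric.infEDist x α := by
    intro x hx
    refine Metric.le_infEDist.2 fun b hb => ?_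
    rw [edist_dist]
    refine ENNReal.ofReal_le_ofReal ?_
    by_cases hb3 : b ∈ Metric.closedBall 0 (3 * R)
    · by_contra! h
      exact hx.2 (Set.mem_biUnion (show b ∈ β from ⟨hb, hb3⟩) h.le)
    · have h1 : ‖x‖ ≤ R := by simpa using hx.1
      have h2 : 3 * R < ‖b‖ := by simpa using hb3
      have h3 : ‖b‖ ≤ ‖x‖ + dist x b := by
        rw [dist_eq_norm]
        simpa using norm_sub_le x (x - b)
      linarith
  have hquarter : (1 / 4 : ℝ≥0∞) ≤ P (Metric.closedBall 0 R \ U) := by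
    have h1 : (1 / 2 : ℝ≥0∞) ≤ P (Metric.closedBall 0 R \ U) + 1 / 4 := by
      refine hPR.trans ((measure_le_inter_add_sdiff P _ U).trans ?_)
      rw [add_comm]
      gcongr
      exact (measure_mono Set.inter_subset_right).trans hPU.le
    have h2 : (1 / 2 : ℝ≥0∞) = 1 / 4 + 1 / 4 := by
      rw [← ENNReal.toReal_eq_toReal_iff' (by simp) (by simp), ENNReal.toReal_add (by simp)
        (by simp)]
      norm_num
    rw [h2] at h1
    exact ENNReal.le_of_add_le_add_right (by simp) h1
  have hlow : ENNReal.ofReal ((T * s) ^ r / 4) ≤ quantErrorPow P r n := by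
    calc ENNReal.ofReal ((T * s) ^ r / 4) = ENNReal.ofReal (T * s) ^ r * (1 / 4) := by
          rw [ENNReal.ofReal_rpow_of_pos (by positivity), div_eq_mul_one_div,
            ENNReal.ofReal_mul (by positivity), ENNReal.ofReal_div_of_pos (by norm_num)]
          simp
      _ ≤ ENNReal.ofReal (T * s) ^ r * P (Metric.closedBall 0 R \ U) := by gcongr
      _ = ∫⁻ _ in Metric.closedBall 0 R \ U, ENNReal.ofReal (T * s) ^ r ∂P := by
          rw [setLIntegral_const]
      _ ≤ ∫⁻ x in Metric.closedBall 0 R \ U, Metric.infEDist x α ^ r ∂P := by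
          refine setLIntegral_mono' (Metric.isClosed_closedBall.measurableSet.diff
            hUc.measurableSet) fun x hx => ?_
          gcongr
          exact hfar x hx
      _ ≤ distortion P r α := setLIntegral_le_lintegral _ _
      _ = quantErrorPow P r n := hα.2
  have hfinal := hlow.trans (hV n s hs hns)
  rw [ENNReal.ofReal_le_ofReal_iff (by positivity), Real.mul_rpow hT0.le hs.le, hTr] at hfinal
  have hsr : 0 < s ^ r := by positivity
  nlinarith

/-- The increments of the quantization error are `O(n ^ (-(1 + r / d)))`. -/
theorem exists_quantErrorPow_le_succ_add (lam : Measure E) [lam.IsAddHaarMeasure]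
    (hd : 0 < Module.finrank ℝ E) (P : Measure E) [IsProbabilityMeasure P] (hP : P ≪ lam)
    {r : ℝ} (hr : 0 < r) (hmom : ∃ δ : ℝ, 0 < δ ∧ ∫⁻ x, ‖x‖ₑ ^ (r + δ) ∂P < ∞) :
    ∃ C s₀ : ℝ, 0 < C ∧ 0 < s₀ ∧ ∀ (n : ℕ) (s : ℝ), 0 < s → s ≤ s₀ →
      ((n + 1 : ℕ) : ℝ) * s ^ Module.finrank ℝ E = 1 →
      ∀ α : Set E, IsOptimalCodebook P r (n + 1) α →
      quantErrorPow P r n ≤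
        quantErrorPow P r (n + 1) + ENNReal.ofReal (C * s ^ (r + Module.finrank ℝ E)) := by
  obtain ⟨C, hC, hV⟩ := exists_quantErrorPow_le lam hd P hr hmom
  obtain ⟨R, c, s₀, hR, hc, hs₀, hcount⟩ :=
    exists_le_encard_inter_closedBall lam hd P hP hr hmom
  set d := Module.finrank ℝ E with hd_def
  set v := lam (Metric.closedBall 0 1) with hv
  have hv0 : v ≠ 0 := (Metric.measure_closedBall_pos lam 0 one_pos).ne'
  have hv1 : v ≠ ∞ := measure_closedBall_lt_top.ne
  -- Points isolated at scale `K * s` have disjoint balls of radius `K * s / 2` inside the ball of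
  -- radius `2R`; this `K` makes them at most half of the `c * N` points available.
  set K : ℝ := 1 + 2 * (4 * R) ^ d / c with hK
  have hK1 : 1 ≤ K := by
    have : 0 < 2 * (4 * R) ^ d / c := by positivity
    linarith
  have hK0 : 0 < K := by linarith
  have hKd : 2 * (4 * R) ^ d / c ≤ K ^ d := le_trans (by linarith) (le_self_pow₀ hK1 hd.ne')
  refine ⟨2 / c * (2 ^ r * (C + K ^ r)), min s₀ (2 * R / K), by positivity, by positivity,
    fun n s hs hss hns α hα => ?_⟩
  have hs1 := hss.trans (min_le_left _ _)
  have hKs : K * s / 2 ≤ R := by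
    have := hss.trans (min_le_right _ _)
    rw [le_div_iff₀ hK0] at this
    linarith
  have hcnt := hcount (n + 1) s hs hs1 hns α hα
  have hN : (0 : ℝ) < ((n + 1 : ℕ) : ℝ) := by positivity
  set N : ℝ := ((n + 1 : ℕ) : ℝ)
  set β := α ∩ Metric.closedBall 0 R with hβ
  set far := {a ∈ β | ENNReal.ofReal (K * s) < Metric.infEDist a (α \ {a})}
  have hfar : (far.encard : ℝ≥0∞) ≤ ENNReal.ofReal (c * N / 2) := by
    have hpack := encard_mul_le_measure lam (u := far) (T := Metric.closedBall 0 (2 * R))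
      (B := fun a => Metric.closedBall a (K * s / 2))
      (c := ENNReal.ofReal ((K * s / 2) ^ d) * v)
      (fun a => Metric.isClosed_closedBall.measurableSet) ?_
      (fun a _ => (Measure.addHaar_closedBall' lam a (by positivity)).ge) ?_
    · rw [Measure.addHaar_closedBall' lam 0 (by positivity), ← mul_assoc,
        ENNReal.mul_le_mul_iff_left hv0 hv1] at hpack
      have h1 : (far.encard : ℝ≥0∞) ≤
          ENNReal.ofReal ((2 * R) ^ d) / ENNReal.ofReal ((K * s / 2) ^ d) :=
        (ENNReal.le_div_iff_mul_le (Or.inl (by simpa using (by positivity : 0 < (K * s / 2) ^ d)))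
          (Or.inl ENNReal.ofReal_ne_top)).2 hpack
      refine h1.trans ?_
      rw [← ENNReal.ofReal_div_of_pos (by positivity)]
      refine ENNReal.ofReal_le_ofReal ?_
      rw [div_le_iff₀ (by positivity)]
      rw [div_le_iff₀ hc] at hKd
      have e1 : (4 * R) ^ d = 2 ^ d * (2 * R) ^ d := by rw [← mul_pow]; ring
      have e2 : c * N / 2 * (K * s / 2) ^ d = c * K ^ d / 2 ^ d / 2 * (N * s ^ d) := by
        rw [div_pow, mul_pow]
        ring
      rw [e2, hns, mul_one, le_div_iff₀ (by norm_num), le_div_iff₀ (by positivity)]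
      linarith
    · intro a ha b hb hab
      refine Metric.closedBall_disjoint_closedBall ?_
      have h1 : ENNReal.ofReal (K * s) < edist a b :=
        ha.2.trans_le (Metric.infEDist_le_edist_of_mem (show b ∈ α \ {a} from ⟨hb.1.1, hab.symm⟩))
      rw [edist_dist, ENNReal.ofReal_lt_ofReal_iff_of_nonneg (by positivity)] at h1
      linarith
    · intro a ha
      refine Metric.closedBall_subset_closedBall' ?_
      have : dist a 0 ≤ R := ha.1.2
      linarith
  have hnear : ENNReal.ofReal (c * N / 2) ≤ ((β \ far).encard : ℝ≥0∞) := by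
    have h1 : (β \ far).encard + far.encard = β.encard :=
      Set.encard_sdiff_add_encard_of_subset fun a ha => ha.1
    rw [← h1, ENat.toENNReal_add, show c * N = c * N / 2 + c * N / 2 by ring,
      ENNReal.ofReal_add (by positivity) (by positivity)] at hcnt
    exact ENNReal.le_of_add_le_add_right ENNReal.ofReal_ne_top (hcnt.trans (by gcongr))
  -- If `a` has a neighbour within `K * s`, then on its cell `f` dominates the `r`-th power of the
  -- distance to `α \ {a}`. So `D` is at most the `f`-weighted mass of each such cell.
  set f : E → ℝ≥0∞ := fun x => 2 ^ r * (Metric.infEDist x α ^ r + ENNReal.ofReal (K * s) ^ r)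
    with hf
  set D := quantErrorPow P r n - quantErrorPow P r (n + 1) with hD
  have hDle : ∀ a ∈ β \ far, D ≤ P.withDensity f (openVoronoiCell a α) := by
    intro a ha
    have haα : a ∈ α := ha.1.1
    have hclose : Metric.infEDist a (α \ {a}) ≤ ENNReal.ofReal (K * s) := by
      by_contra! h
      exact ha.2 ⟨ha.1, h⟩
    rw [hD, tsub_le_iff_left, withDensity_apply _ (measurableSet_openVoronoiCell a α), ← hα.2]
    refine (quantErrorPow_le_distortion P r (encard_sdiff_singleton_le haα hα.1)).trans
      ((distortion_sdiff_le P r haα).trans ?_)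
    refine add_le_add_right ?_ _
    refine setLIntegral_mono' (measurableSet_openVoronoiCell a α) fun x hx => ?_
    simp only [hf]
    rw [← show edist x a = Metric.infEDist x α from openVoronoiCell_subset_voronoiCell haα hx]
    refine le_trans ?_ (ENNReal.add_rpow_le_two_rpow_mul _ _ hr.le)
    gcongr
    exact Metric.infEDist_le_edist_add_infEDist.trans (by gcongr)
  have hsum := encard_mul_le_measure (P.withDensity f) (u := β \ far) (T := Set.univ)
    (fun a => measurableSet_openVoronoiCell a α)
    ((pairwiseDisjoint_openVoronoiCell α).subset fun a ha => ha.1.1) hDle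
    (fun a _ => Set.subset_univ _)
  have htot : P.withDensity f Set.univ ≤ ENNReal.ofReal (2 ^ r * (C + K ^ r) * s ^ r) := by
    rw [withDensity_apply _ MeasurableSet.univ, Measure.restrict_univ, hf,
      lintegral_const_mul' _ _ (ENNReal.rpow_ne_top_of_nonneg hr.le ENNReal.ofNat_ne_top),
      lintegral_add_right _ measurable_const, lintegral_const, measure_univ, mul_one]
    have h1 : ∫⁻ x, Metric.infEDist x α ^ r ∂P ≤ ENNReal.ofReal (C * s ^ r) :=
      (hα.2.trans_le (hV (n + 1) s hs hns))
    calc (2 : ℝ≥0∞) ^ r * (∫⁻ x, Metric.infEDist x α ^ r ∂P + ENNReal.ofReal (K * s) ^ r)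
        ≤ 2 ^ r * (ENNReal.ofReal (C * s ^ r) + ENNReal.ofReal (K * s) ^ r) := by gcongr
      _ = ENNReal.ofReal (2 ^ r * (C + K ^ r) * s ^ r) := by
        rw [ENNReal.ofReal_rpow_of_pos (by positivity),
          ← ENNReal.ofReal_add (by positivity) (by positivity),
          show (2 : ℝ≥0∞) = ENNReal.ofReal 2 by simp,
          ENNReal.ofReal_rpow_of_pos (by norm_num), ← ENNReal.ofReal_mul (by positivity),
          Real.mul_rpow hK0.le hs.le]
        congr 1
        ring
  have hcN : 0 < c * N / 2 := by positivity
  have hDfin : D ≤ ENNReal.ofReal (2 / c * (2 ^ r * (C + K ^ r)) * s ^ (r + d)) := by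
    have h1 : D * ENNReal.ofReal (c * N / 2) ≤ ENNReal.ofReal (2 ^ r * (C + K ^ r) * s ^ r) := by
      rw [mul_comm]
      exact (mul_le_mul_left hnear D).trans (hsum.trans htot)
    refine ((ENNReal.le_div_iff_mul_le (Or.inl (by simpa using hcN))
      (Or.inl ENNReal.ofReal_ne_top)).2 h1).trans (le_of_eq ?_)
    rw [← ENNReal.ofReal_div_of_pos hcN]
    congr 1
    rw [div_eq_iff hcN.ne', Real.rpow_add hs, Real.rpow_natCast]
    field_simp
    linear_combination -hns
  exact le_add_tsub.trans (by gcongr)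

end Increment

/-! ### Lower bound for the increments -/

section Increment

variable {E : Type*} [NormedAddCommGroup E] [NormedSpace ℝ E] [FiniteDimensional ℝ E]
  [MeasurableSpace E] [BorelSpace E]

/-- On a set of positive measure, an absolutely continuous measure gives small balls uniformly at
least a multiple of their Lebesgue measure. -/
lemma exists_measure_lower_density_ne_zero (lam : Measure E) [lam.IsAddHaarMeasure]
    (P : Measure E) [IsProbabilityMeasure P] (hP : P ≪ lam) :
    ∃ k : ℕ, lam {y | ∀ t : ℝ, 0 < t → t < ((k : ℝ) + 1)⁻¹ →
      ENNReal.ofReal ((k : ℝ) + 1)⁻¹ * lam (Metric.closedBall y t) ≤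
        P (Metric.closedBall y t)} ≠ 0 := by
  by_contra! hnull
  have hae := ae_all_iff.2 fun k => measure_eq_zero_iff_ae_notMem.1 (hnull k)
  have hzero : P.rnDeriv lam =ᵐ[lam] 0 := by
    -- Where the derivative is positive, ball ratios eventually exceed some `q > 0`. A single `k`
    -- with `1 / (k + 1)` below both `q` and the radius threshold puts `y` in the `k`-th set.
    filter_upwards [Besicovitch.ae_tendsto_rnDeriv P lam, hae] with y hy hG
    by_contra hne
    obtain ⟨q, hq0, hq⟩ := ENNReal.lt_iff_exists_nnreal_btwn.1 (pos_iff_ne_zero.2 hne)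
    obtain ⟨ε, hε, hsub⟩ := mem_nhdsGT_iff_exists_Ioo_subset.1 (hy.eventually_const_lt hq)
    have hq0' : (0 : ℝ) < q := by exact_mod_cast hq0
    obtain ⟨k, hk⟩ := exists_nat_one_div_lt (lt_min hq0' hε)
    rw [one_div] at hk
    refine hG k fun t ht htk => ?_
    have h1 : (q : ℝ≥0∞) < P (Metric.closedBall y t) / lam (Metric.closedBall y t) :=
      hsub ⟨ht, htk.trans (hk.trans_le (min_le_right _ _))⟩
    have h2 : ENNReal.ofReal ((k : ℝ) + 1)⁻¹ ≤ q := by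
      rw [← ENNReal.ofReal_coe_nnreal]
      exact ENNReal.ofReal_le_ofReal (hk.le.trans (min_le_left _ _))
    exact (ENNReal.le_div_iff_mul_le (Or.inl (Metric.measure_closedBall_pos lam y ht).ne')
      (Or.inl measure_closedBall_lt_top.ne)).1 (h2.trans h1.le)
  have h0 : P = 0 := by
    rw [← Measure.withDensity_rnDeriv_eq P lam hP, withDensity_congr_ae hzero]
    simp
  exact IsProbabilityMeasure.ne_zero P h0

/-- The increments of the quantization error are at least of order `n ^ (-(1 + r / d))`. -/
theorem exists_quantErrorPow_succ_add_le (lam : Measure E) [lam.IsAddHaarMeasure]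
    (hd : 0 < Module.finrank ℝ E) (P : Measure E) [IsProbabilityMeasure P] (hP : P ≪ lam)
    {r : ℝ} (hr : 0 < r) :
    ∃ c s₀ : ℝ, 0 < c ∧ 0 < s₀ ∧ ∀ (n : ℕ) (s : ℝ), 0 < s → s ≤ s₀ →
      n * s ^ Module.finrank ℝ E = 1 → ∀ α : Set E, IsOptimalCodebook P r n α →
      quantErrorPow P r (n + 1) + ENNReal.ofReal (c * s ^ (r + Module.finrank ℝ E)) ≤
        quantErrorPow P r n := by
  obtain ⟨k, hk⟩ := exists_measure_lower_density_ne_zero lam P hP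
  set G := {y | ∀ t : ℝ, 0 < t → t < ((k : ℝ) + 1)⁻¹ →
      ENNReal.ofReal ((k : ℝ) + 1)⁻¹ * lam (Metric.closedBall y t) ≤
        P (Metric.closedBall y t)} with hG
  set d := Module.finrank ℝ E with hd_def
  set v := lam (Metric.closedBall 0 1) with hv
  have hv0 : v ≠ 0 := (Metric.measure_closedBall_pos lam 0 one_pos).ne'
  have hv1 : v ≠ ∞ := measure_closedBall_lt_top.ne
  have hvpos : 0 < v.toReal := ENNReal.toReal_pos hv0 hv1
  obtain ⟨q, hq, hqv⟩ := ENNReal.exists_nnreal_pos_mul_lt hv1 hk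
  have hq' : (0 : ℝ) < q := by exact_mod_cast hq
  -- `T ^ d ≤ q` keeps the volume of the `T * s`-balls about `α` below `lam G`; `T ≤ 1` and `s ≤ m`
  -- keep the radius `T * s / 4` admissible in `G`.
  set T : ℝ := min 1 q with hT
  have hT0 : 0 < T := lt_min one_pos hq'
  have hT1 : T ≤ 1 := min_le_left _ _
  have hTq : T ^ d ≤ q := (pow_le_of_le_one hT0.le hT1 hd.ne').trans (min_le_right _ _)
  set κ : ℝ := (3 / 4) ^ r - (1 / 4) ^ r with hκ
  have hκ0 : 0 < κ := sub_pos.2 (Real.rpow_lt_rpow (by norm_num) (by norm_num) hr)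
  set m : ℝ := ((k : ℝ) + 1)⁻¹ with hm
  have hm0 : 0 < m := by positivity
  refine ⟨κ * T ^ r * (m * ((T / 4) ^ d * v.toReal)), m, by positivity, hm0,
    fun n s hs hsm hns α hα => ?_⟩
  have hαfin : α.Finite := Set.finite_of_encard_le_coe hα.1
  have hU : lam (⋃ b ∈ α, Metric.closedBall b (T * s)) < lam G := by
    refine lt_of_le_of_lt ((measure_biUnion_closedBall_le lam hαfin.countable
      (by positivity)).trans ?_) hqv
    rw [← mul_assoc]
    refine mul_le_mul_left ?_ v
    calc (α.encard : ℝ≥0∞) * ENNReal.ofReal ((T * s) ^ d)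
        ≤ (n : ℝ≥0∞) * ENNReal.ofReal ((T * s) ^ d) := by
          gcongr
          rw [← ENat.toENNReal_coe]
          exact ENat.toENNReal_le.2 hα.1
      _ = ENNReal.ofReal (T ^ d) := by
          rw [← ENNReal.ofReal_natCast, ← ENNReal.ofReal_mul (by positivity), mul_pow,
            mul_left_comm, hns, mul_one]
      _ ≤ ENNReal.ofReal q := ENNReal.ofReal_le_ofReal hTq
      _ = q := ENNReal.ofReal_coe_nnreal
  -- Only monotonicity of `lam` is needed, so `G` need not be measurable.
  obtain ⟨y, hyG, hyU⟩ := Set.not_subset.1 fun h => (measure_mono h).not_gt hU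
  have hfar : ENNReal.ofReal (T * s) ≤ Metric.infEDist y α := by
    refine Metric.le_infEDist.2 fun b hb => ?_
    rw [edist_dist]
    refine ENNReal.ofReal_le_ofReal ?_
    by_contra! h
    exact hyU (Set.mem_biUnion hb h.le)
  have hTs : 0 < T * s := by positivity
  refine le_trans ?_ (quantErrorPow_succ_add_le hr hα hTs hfar)
  refine add_le_add_right ?_ _
  have hball := hyG (T * s / 4) (by positivity) (by nlinarith)
  rw [Measure.addHaar_closedBall' lam y (by positivity), ← hv, ← ENNReal.ofReal_toReal hv1,
    ← ENNReal.ofReal_mul (by positivity), ← ENNReal.ofReal_mul (by positivity)] at hball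
  calc ENNReal.ofReal (κ * T ^ r * (m * ((T / 4) ^ d * v.toReal)) * s ^ (r + d))
      = ENNReal.ofReal (κ * (T * s) ^ r) *
          ENNReal.ofReal (m * ((T * s / 4) ^ d * v.toReal)) := by
        rw [← ENNReal.ofReal_mul (by positivity), Real.mul_rpow hT0.le hs.le, Real.rpow_add hs,
          Real.rpow_natCast, mul_div_right_comm, mul_pow]
        congr 1
        ring
    _ ≤ _ := mul_le_mul' le_rfl hball

end Increment

/-- The typical spacing `n ^ (-1 / d)` of `n` points in dimension `d`. -/
noncomputable def meshSize (d n : ℕ) : ℝ := (n : ℝ) ^ (-(1 / (d : ℝ)))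

/-! ### Powers of the mesh size -/

section MeshSize

variable {d n : ℕ}

lemma meshSize_pos (hn : 1 ≤ n) : 0 < meshSize d n :=
  Real.rpow_pos_of_pos (by exact_mod_cast hn) _

lemma natCast_mul_meshSize_pow (hd : 0 < d) (hn : 1 ≤ n) : n * meshSize d n ^ d = 1 := by
  have hn' : (0 : ℝ) < n := by exact_mod_cast hn
  have hd' : (d : ℝ) ≠ 0 := by exact_mod_cast hd.ne'
  rw [meshSize, ← Real.rpow_natCast, ← Real.rpow_mul hn'.le, neg_mul, one_div_mul_cancel hd',
    Real.rpow_neg_one, mul_inv_cancel₀ hn'.ne']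

lemma meshSize_succ_le (hn : 1 ≤ n) : meshSize d (n + 1) ≤ meshSize d n := by
  refine Real.rpow_le_rpow_of_nonpos (by exact_mod_cast hn) (by push_cast; linarith) ?_
  rw [neg_nonpos]
  positivity

lemma tendsto_meshSize (hd : 0 < d) : Tendsto (meshSize d) atTop (nhds 0) :=
  (tendsto_rpow_neg_atTop (by positivity : (0 : ℝ) < 1 / d)).comp tendsto_natCast_atTop_atTop

lemma natCast_rpow_mul_meshSize_rpow (hd : 0 < d) (hn : 1 ≤ n) (r : ℝ) :
    (n : ℝ≥0∞) ^ (1 + r / (d : ℝ)) * ENNReal.ofReal (meshSize d n ^ (r + d)) = 1 := by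
  have hn' : (0 : ℝ) < n := by exact_mod_cast hn
  have hd' : (d : ℝ) ≠ 0 := by exact_mod_cast hd.ne'
  rw [← ENNReal.ofReal_natCast, ENNReal.ofReal_rpow_of_pos hn',
    ← ENNReal.ofReal_mul (by positivity), meshSize, ← Real.rpow_mul hn'.le, ← Real.rpow_add hn',
    ← ENNReal.ofReal_one]
  congr 1
  rw [show 1 + r / (d : ℝ) + -(1 / (d : ℝ)) * (r + d) = 0 by field_simp; ring, Real.rpow_zero]

end MeshSize

/-! ### Estimates for a single cell -/

section LocalDensity

/-- Near a point of continuity of the density, the measure is comparable to Lebesgue measure. -/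
lemma exists_ball_measure_bounds {E : Type*} [PseudoMetricSpace E] [MeasurableSpace E]
    {lam P : Measure E} {h : E → ℝ≥0} (hP : P = lam.withDensity (fun y => (h y : ℝ≥0∞)))
    {x : E} (hc : ContinuousAt h x) (hx : 0 < h x) :
    ∃ η : ℝ, 0 < η ∧ ∀ A ⊆ Metric.ball x η, MeasurableSet A →
      ENNReal.ofReal (h x / 2) * lam A ≤ P A ∧ P A ≤ ENNReal.ofReal (2 * h x) * lam A := by
  have h1 : h x / 2 < h x := NNReal.half_lt_self hx.ne'
  have h2 : h x < 2 * h x := by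
    rw [two_mul]
    exact lt_add_of_pos_left _ hx
  obtain ⟨η, hη, hball⟩ := Metric.eventually_nhds_iff_ball.1
    ((hc.eventually_const_lt h1).and (hc.eventually_lt_const h2))
  have e1 : ENNReal.ofReal (h x / 2) = ((h x / 2 : ℝ≥0) : ℝ≥0∞) := by
    rw [← ENNReal.ofReal_coe_nnreal]
    push_cast
    rfl
  have e2 : ENNReal.ofReal (2 * h x) = ((2 * h x : ℝ≥0) : ℝ≥0∞) := by
    rw [← ENNReal.ofReal_coe_nnreal]
    push_cast
    rfl
  refine ⟨η, hη, fun A hA hAm => ?_⟩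
  rw [hP, withDensity_apply _ hAm, e1, e2, ← setLIntegral_const, ← setLIntegral_const]
  exact ⟨setLIntegral_mono' hAm fun y hy => ENNReal.coe_le_coe.2 (hball y (hA hy)).1.le,
    setLIntegral_mono' hAm fun y hy => ENNReal.coe_le_coe.2 (hball y (hA hy)).2.le⟩

end LocalDensity

section Local

variable {E : Type*} [NormedAddCommGroup E] [MeasurableSpace E] [BorelSpace E]
  {P : Measure E} {r : ℝ} {α : Set E} {a x : E} {ρ η : ℝ}

lemma localInertia_le (hr : 0 < r) (hsub : voronoiCell a α ⊆ Metric.closedBall a ρ) :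
    localInertia P r a α ≤ ENNReal.ofReal ρ ^ r * P (voronoiCell a α) := by
  rw [localInertia, ← setLIntegral_const]
  refine setLIntegral_mono' (measurableSet_voronoiCell a α) fun y hy => ?_
  gcongr
  rw [edist_dist]
  exact ENNReal.ofReal_le_ofReal (hsub hy)

/-- Markov-type bound: the part of the cell outside `closedBall a t` has mass at least `m` and lies
farther than `t` from `a`. -/
lemma le_localInertia (hr : 0 < r) {t : ℝ} {m : ℝ≥0∞}
    (hm : m + P (Metric.closedBall a t) ≤ P (voronoiCell a α))
    (hfin : P (Metric.closedBall a t) ≠ ∞) :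
    ENNReal.ofReal t ^ r * m ≤ localInertia P r a α := by
  have hB : MeasurableSet (Metric.closedBall a t) := Metric.isClosed_closedBall.measurableSet
  have h1 : m ≤ P (voronoiCell a α \ Metric.closedBall a t) := by
    have h2 : P (voronoiCell a α) ≤
        P (voronoiCell a α \ Metric.closedBall a t) + P (Metric.closedBall a t) := by
      refine (measure_le_inter_add_sdiff P _ (Metric.closedBall a t)).trans ?_
      rw [add_comm]
      gcongr
      exact Set.inter_subset_right
    exact ENNReal.le_of_add_le_add_right hfin (hm.trans h2)
  calc ENNReal.ofReal t ^ r * m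
      ≤ ENNReal.ofReal t ^ r * P (voronoiCell a α \ Metric.closedBall a t) := by gcongr
    _ = ∫⁻ _ in voronoiCell a α \ Metric.closedBall a t, ENNReal.ofReal t ^ r ∂P := by
        rw [setLIntegral_const]
    _ ≤ ∫⁻ y in voronoiCell a α \ Metric.closedBall a t, edist y a ^ r ∂P := by
        refine setLIntegral_mono' ((measurableSet_voronoiCell a α).diff hB) fun y hy => ?_
        gcongr
        rw [edist_dist]
        exact ENNReal.ofReal_le_ofReal (not_le.1 hy.2).le
    _ ≤ localInertia P r a α := lintegral_mono_set Set.sdiff_subset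

variable [NormedSpace ℝ E]

/-- The probability of an open cell is bounded below by the cost of removing its centre. -/
lemma increment_le_measure_openVoronoiCell [Nontrivial E] (hr : 0 < r) {n : ℕ}
    (hα : IsOptimalCodebook P r (n + 1) α) (hfin : quantErrorPow P r (n + 1) ≠ ∞) {D : ℝ≥0∞}
    (hD : quantErrorPow P r (n + 1) + D ≤ quantErrorPow P r n) (hρ : 0 < ρ) (hη : 3 * ρ < η)
    (hU : ∀ y ∈ Metric.ball x η, Metric.infEDist y α < ENNReal.ofReal ρ)
    (ha : a ∈ α) (hx : x ∈ voronoiCell a α) :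
    D ≤ ENNReal.ofReal (4 * ρ) ^ r * P (openVoronoiCell a α) := by
  have hsub := voronoiCell_subset_closedBall hρ (by linarith) hU ha hx
  have hclose := infEDist_sdiff_le_of_dense hρ hη hU hx
  -- Removing `a` leaves a competitor with `n` points. On the open cell its distance is at most `ρ +
  -- 3ρ`, by way of the neighbour of `a`.
  have h1 : quantErrorPow P r (n + 1) + D ≤ quantErrorPow P r (n + 1) +
      ∫⁻ z in openVoronoiCell a α, Metric.infEDist z (α \ {a}) ^ r ∂P := by
    refine hD.trans ((quantErrorPow_le_distortion P r
      (encard_sdiff_singleton_le ha hα.1)).trans ?_)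
    rw [← hα.2]
    exact distortion_sdiff_le P r ha
  refine ((ENNReal.add_le_add_iff_left hfin).1 h1).trans ?_
  rw [← setLIntegral_const]
  refine setLIntegral_mono' (measurableSet_openVoronoiCell a α) fun z hz => ?_
  gcongr
  have hza : edist z a ≤ ENNReal.ofReal ρ := by
    rw [edist_dist]
    exact ENNReal.ofReal_le_ofReal (hsub (openVoronoiCell_subset_voronoiCell ha hz))
  calc Metric.infEDist z (α \ {a}) ≤ edist z a + Metric.infEDist a (α \ {a}) :=
        Metric.infEDist_le_edist_add_infEDist
    _ ≤ ENNReal.ofReal ρ + ENNReal.ofReal (3 * ρ) := by gcongr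
    _ = ENNReal.ofReal (4 * ρ) := by
        rw [← ENNReal.ofReal_add hρ.le (by positivity)]
        congr 1
        ring

variable [FiniteDimensional ℝ E]

/-- An optimal codebook is dense near a point with positive density, at the scale
`(D / H) ^ (1 / (r + d))` where `D` bounds the increment of the quantization error and `H` the
density. -/
lemma infEDist_lt_of_increment_le {lam : Measure E} [lam.IsAddHaarMeasure]
    (hr : 0 < r) {n : ℕ} (hα : IsOptimalCodebook P r n α)
    (hfin : quantErrorPow P r (n + 1) ≠ ∞) {D H : ℝ} (hH : 0 ≤ H) (hρ : 0 < ρ)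
    (hD : quantErrorPow P r n ≤ quantErrorPow P r (n + 1) + ENNReal.ofReal D) {y : E}
    (hlow : ENNReal.ofReal H * lam (Metric.closedBall y (ρ / 4)) ≤
      P (Metric.closedBall y (ρ / 4)))
    (hlt : max D 0 < ((3 / 4) ^ r - (1 / 4) ^ r) * ρ ^ r *
      (H * ((ρ / 4) ^ Module.finrank ℝ E * (lam (Metric.closedBall 0 1)).toReal))) :
    Metric.infEDist y α < ENNReal.ofReal ρ := by
  by_contra! hfar
  have h1 := (quantErrorPow_succ_add_le hr hα hρ hfar).trans hD
  rw [ENNReal.add_le_add_iff_left hfin] at h1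
  have hκ : (0 : ℝ) ≤ (3 / 4) ^ r - (1 / 4) ^ r :=
    sub_nonneg.2 (Real.rpow_le_rpow (by norm_num) (by norm_num) hr.le)
  have hv1 : lam (Metric.closedBall 0 1) ≠ ∞ := measure_closedBall_lt_top.ne
  rw [Measure.addHaar_closedBall' lam y (by positivity), ← ENNReal.ofReal_toReal hv1,
    ← ENNReal.ofReal_mul (by positivity), ← ENNReal.ofReal_mul (by positivity)] at hlow
  have h2 := (mul_le_mul' le_rfl hlow).trans h1
  rw [← ENNReal.ofReal_mul (by positivity)] at h2
  have h3 := (ENNReal.ofReal_le_ofReal_iff' (q := D)).1 h2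
  rcases h3 with h3 | h3
  · exact (hlt.trans_le h3).not_ge (le_max_left _ _)
  · exact (hlt.trans_le h3).not_ge (le_max_right _ _)

/-- Upper and lower bounds for a single Voronoi cell. -/
lemma voronoiCell_bounds [Nontrivial E] {lam : Measure E} [lam.IsAddHaarMeasure]
    [IsFiniteMeasure P] (hr : 0 < r) {n : ℕ} (hα : IsOptimalCodebook P r (n + 1) α)
    (hfin : quantErrorPow P r (n + 1) ≠ ∞) {c s τ K J H : ℝ} (hc : 0 < c) (hs : 0 < s)
    (hτ : 0 < τ) (hK : 0 < K) (hJ : 0 < J) (hJK : J ≤ K) (hH : 0 < H)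
    (hHτ : H * τ ^ (Module.finrank ℝ E) = τ ^ (-r))
    (hJc : (lam (Metric.closedBall 0 1)).toReal * J ^ Module.finrank ℝ E ≤ c / (4 * K) ^ r / 4)
    (hD : quantErrorPow P r (n + 1) + ENNReal.ofReal (c * s ^ (r + Module.finrank ℝ E)) ≤
      quantErrorPow P r n)
    (hη : 4 * (K * τ * s) < η)
    (hU : ∀ y ∈ Metric.ball x η, Metric.infEDist y α < ENNReal.ofReal (K * τ * s))
    (hPlam : ∀ A ⊆ Metric.ball x η, MeasurableSet A → P A ≤ ENNReal.ofReal (2 * H) * lam A)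
    (ha : a ∈ α) (hx : x ∈ voronoiCell a α) :
    ENNReal.ofReal (c / (4 * K) ^ r * (τ ^ (-r) * s ^ Module.finrank ℝ E)) ≤
        P (openVoronoiCell a α) ∧
      P (voronoiCell a α) ≤ ENNReal.ofReal (2 * (lam (Metric.closedBall 0 1)).toReal *
        K ^ Module.finrank ℝ E * (τ ^ (-r) * s ^ Module.finrank ℝ E)) ∧
      ENNReal.ofReal (J ^ r * (c / (4 * K) ^ r) / 2 * s ^ (r + Module.finrank ℝ E)) ≤
        localInertia P r a α ∧
      localInertia P r a α ≤ ENNReal.ofReal (2 * (lam (Metric.closedBall 0 1)).toReal *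
        K ^ Module.finrank ℝ E * K ^ r * s ^ (r + Module.finrank ℝ E)) := by
  set d := Module.finrank ℝ E
  set v := (lam (Metric.closedBall 0 1)).toReal with hv
  have hv1 : lam (Metric.closedBall 0 1) ≠ ∞ := measure_closedBall_lt_top.ne
  have hv0 : 0 ≤ v := ENNReal.toReal_nonneg
  have hρ : 0 < K * τ * s := by positivity
  have hxa := dist_lt_of_mem_voronoiCell_center (by linarith) hU hx
  have hsub := voronoiCell_subset_closedBall hρ (by linarith) hU ha hx
  have hττ : τ ^ r * τ ^ (-r) = 1 := by rw [← Real.rpow_add hτ]; simp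
  have hball : ∀ t : ℝ, 0 < t → t ≤ K * τ * s →
      P (Metric.closedBall a t) ≤ ENNReal.ofReal (2 * H * (t ^ d * v)) := by
    intro t ht htρ
    refine (hPlam _ (fun y hy => ?_) Metric.isClosed_closedBall.measurableSet).trans
      (le_of_eq ?_)
    · rw [Metric.mem_closedBall] at hy
      rw [Metric.mem_ball]
      have := dist_triangle y a x
      rw [dist_comm a x] at this
      linarith
    · rw [Measure.addHaar_closedBall' lam a ht.le, ← ENNReal.ofReal_toReal hv1,
        ← ENNReal.ofReal_mul (by positivity), ← ENNReal.ofReal_mul (by positivity)]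
  -- The relation `H * τ ^ d = τ ^ (-r)` turns the mass bound for balls of radius `b * τ * s` into
  -- the scale `τ ^ (-r) * s ^ d` of the lower bound.
  have hscale : ∀ b : ℝ, 2 * H * ((b * τ * s) ^ d * v) = 2 * v * b ^ d * (τ ^ (-r) * s ^ d) := by
    intro b
    rw [← hHτ, mul_pow, mul_pow]
    ring
  have hopen : ENNReal.ofReal (c / (4 * K) ^ r * (τ ^ (-r) * s ^ d)) ≤
      P (openVoronoiCell a α) := by
    have h1 := increment_le_measure_openVoronoiCell hr hα hfin hD hρ (by linarith) hU ha hx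
    rw [ENNReal.ofReal_rpow_of_pos (by positivity)] at h1
    have h2 := ENNReal.div_le_of_le_mul' h1
    rw [← ENNReal.ofReal_div_of_pos (by positivity)] at h2
    convert h2 using 2
    rw [eq_div_iff (by positivity), show 4 * (K * τ * s) = 4 * K * τ * s by ring,
      Real.mul_rpow (by positivity) hs.le, Real.mul_rpow (by positivity) hτ.le,
      Real.rpow_add hs, Real.rpow_natCast]
    have hK' : (4 * K) ^ r ≠ 0 := by positivity
    field_simp
    linear_combination hττ
  have hclosed : P (voronoiCell a α) ≤ ENNReal.ofReal (2 * v * K ^ d * (τ ^ (-r) * s ^ d)) := by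
    rw [← hscale]
    exact (measure_mono hsub).trans (hball _ hρ le_rfl)
  refine ⟨hopen, hclosed, ?_, ?_⟩
  · have hJρ : J * τ * s ≤ K * τ * s := by gcongr
    have hsmall := hball (J * τ * s) (by positivity) hJρ
    -- By `hJc` the ball of radius `J * τ * s` takes at most half of the lower bound for the cell;
    -- the other half remains outside.
    have h1 : ENNReal.ofReal (c / (4 * K) ^ r / 2 * (τ ^ (-r) * s ^ d)) +
        P (Metric.closedBall a (J * τ * s)) ≤ P (voronoiCell a α) := by
      refine le_trans ?_ (hopen.trans (measure_mono (openVoronoiCell_subset_voronoiCell ha)))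
      refine (add_le_add_right hsmall _).trans ?_
      rw [← ENNReal.ofReal_add (by positivity) (by positivity), hscale]
      refine ENNReal.ofReal_le_ofReal ?_
      rw [← add_mul]
      gcongr
      linarith
    refine le_trans (le_of_eq ?_) (le_localInertia hr h1 (measure_ne_top _ _))
    rw [ENNReal.ofReal_rpow_of_pos (by positivity), ← ENNReal.ofReal_mul (by positivity)]
    congr 1
    rw [Real.mul_rpow (by positivity) hs.le, Real.mul_rpow hJ.le hτ.le, Real.rpow_add hs,
      Real.rpow_natCast]
    linear_combination (-(J ^ r * s ^ r * (c / (4 * K) ^ r / 2) * s ^ d)) * hττ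
  · refine (localInertia_le hr hsub).trans ((mul_le_mul' le_rfl hclosed).trans (le_of_eq ?_))
    rw [ENNReal.ofReal_rpow_of_pos (by positivity), ← ENNReal.ofReal_mul (by positivity)]
    congr 1
    rw [Real.mul_rpow (by positivity) hs.le, Real.mul_rpow hK.le hτ.le, Real.rpow_add hs,
      Real.rpow_natCast]
    linear_combination (K ^ r * s ^ r * (2 * v * K ^ d) * s ^ d) * hττ

end Local

/-! ### Choice of constants and passage to the limit -/

section Main

variable {E : Type*} [NormedAddCommGroup E] [NormedSpace ℝ E] [FiniteDimensional ℝ E]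
  [MeasurableSpace E] [BorelSpace E]

/-- Two-sided bound on the increments of the quantization error, along a sequence of optimal
codebooks. -/
lemma exists_eventually_increment_bounds [Nontrivial E] (lam : Measure E) [lam.IsAddHaarMeasure]
    (P : Measure E) [IsProbabilityMeasure P] (hP : P ≪ lam) {r : ℝ} (hr : 0 < r)
    (hmom : ∃ δ : ℝ, 0 < δ ∧ ∫⁻ x, ‖x‖ₑ ^ (r + δ) ∂P < ∞) :
    ∃ c C : ℝ, 0 < c ∧ 0 < C ∧ ∀ α : ℕ → Set E,
      (∀ n, 1 ≤ n → IsOptimalCodebook P r n (α n)) → ∀ᶠ n : ℕ in atTop,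
        quantErrorPow P r (n + 1) ≠ ∞ ∧
        quantErrorPow P r (n + 1) ≤ quantErrorPow P r (n + 1 + 1) +
          ENNReal.ofReal (C * meshSize (Module.finrank ℝ E) (n + 1) ^
            (r + Module.finrank ℝ E)) ∧
        quantErrorPow P r (n + 1) +
          ENNReal.ofReal (c * meshSize (Module.finrank ℝ E) (n + 1) ^
            (r + Module.finrank ℝ E)) ≤ quantErrorPow P r n := by
  have hd : 0 < Module.finrank ℝ E := Module.finrank_pos
  obtain ⟨C₀, -, hV⟩ := exists_quantErrorPow_le lam hd P hr hmom
  obtain ⟨C, s₁, hC, hs₁, hup⟩ := exists_quantErrorPow_le_succ_add lam hd P hP hr hmom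
  obtain ⟨c, s₂, hc, hs₂, hlow⟩ := exists_quantErrorPow_succ_add_le lam hd P hP hr
  set d := Module.finrank ℝ E
  refine ⟨c, C, hc, hC, fun α hα => ?_⟩
  filter_upwards [eventually_ge_atTop 1,
    (tendsto_meshSize hd).eventually_le_const (lt_min hs₁ hs₂)] with n hn hsmall
  -- Both increments are expressed at the mesh size of `n + 1`: the upper one comes from the smaller
  -- mesh of `n + 2`, the lower one from the larger mesh of `n`.
  have h1 := meshSize_succ_le (d := d) hn
  have h2 := meshSize_succ_le (d := d) (Nat.le_add_left 1 n)
  have hp1 : 0 < meshSize d (n + 1) := meshSize_pos (Nat.le_add_left 1 n)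
  have hp2 : 0 < meshSize d (n + 1 + 1) := meshSize_pos (Nat.le_add_left 1 _)
  refine ⟨?_, ?_, ?_⟩
  · exact ne_top_of_le_ne_top ENNReal.ofReal_ne_top
      (hV (n + 1) _ hp1 (natCast_mul_meshSize_pow hd (Nat.le_add_left 1 n)))
  · refine (hup (n + 1) _ hp2 ?_ (natCast_mul_meshSize_pow hd (Nat.le_add_left 1 _)) _
      (hα _ (Nat.le_add_left 1 _))).trans ?_
    · exact (h2.trans h1).trans (hsmall.trans (min_le_left _ _))
    · gcongr
  · refine le_trans ?_ (hlow n _ (meshSize_pos hn) (hsmall.trans (min_le_right _ _))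
      (natCast_mul_meshSize_pow hd hn) _ (hα n hn))
    gcongr

/-- The bounds for the Voronoi cell of `x` at stage `n`, in the form in which the powers of `n`
are absorbed in `meshSize`. -/
lemma exists_eventually_voronoiCell_bounds [Nontrivial E] (lam : Measure E)
    [lam.IsAddHaarMeasure] (P : Measure E) [IsProbabilityMeasure P] (hP : P ≪ lam) {r : ℝ}
    (hr : 0 < r) (hmom : ∃ δ : ℝ, 0 < δ ∧ ∫⁻ x, ‖x‖ₑ ^ (r + δ) ∂P < ∞) :
    ∃ c₁ c₂ c₃ c₄ : ℝ, 0 < c₁ ∧ 0 < c₂ ∧ 0 < c₃ ∧ 0 < c₄ ∧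
      ∀ h : E → ℝ≥0, P = lam.withDensity (fun y => (h y : ℝ≥0∞)) →
      ∀ α : ℕ → Set E, (∀ n, 1 ≤ n → IsOptimalCodebook P r n (α n)) →
      ∀ x : E, ContinuousAt h x → 0 < h x →
      ∀ a : ℕ → E, (∀ n, 1 ≤ n → a n ∈ α n ∧ x ∈ voronoiCell (a n) (α n)) →
      ∀ᶠ n : ℕ in atTop,
        ENNReal.ofReal (c₁ * ((h x : ℝ) ^ (r / (r + Module.finrank ℝ E)) *
            meshSize (Module.finrank ℝ E) n ^ Module.finrank ℝ E)) ≤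
          P (openVoronoiCell (a n) (α n)) ∧
        P (voronoiCell (a n) (α n)) ≤
          ENNReal.ofReal (c₂ * ((h x : ℝ) ^ (r / (r + Module.finrank ℝ E)) *
            meshSize (Module.finrank ℝ E) n ^ Module.finrank ℝ E)) ∧
        ENNReal.ofReal (c₃ * meshSize (Module.finrank ℝ E) n ^ (r + Module.finrank ℝ E)) ≤
          localInertia P r (a n) (α n) ∧
        localInertia P r (a n) (α n) ≤
          ENNReal.ofReal (c₄ * meshSize (Module.finrank ℝ E) n ^ (r + Module.finrank ℝ E)) := by
  have hd : 0 < Module.finrank ℝ E := Module.finrank_pos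
  obtain ⟨c, C, hc, hC, hinc⟩ := exists_eventually_increment_bounds lam P hP hr hmom
  set d := Module.finrank ℝ E with hd_def
  set v := (lam (Metric.closedBall 0 1)).toReal with hv
  have hv0 : 0 < v := ENNReal.toReal_pos (Metric.measure_closedBall_pos lam 0 one_pos).ne'
    measure_closedBall_lt_top.ne
  set κ : ℝ := (3 / 4) ^ r - (1 / 4) ^ r with hκ
  have hκ0 : 0 < κ := sub_pos.2 (Real.rpow_lt_rpow (by norm_num) (by norm_num) hr)
  have hd1 : (1 : ℝ) ≤ d := by exact_mod_cast hd
  have hrd : 0 < r + d := by positivity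
  -- Chosen so that a hole of radius `K * τ * s` would gain more than `C * s ^ (r + d)`; the 2 comes
  -- from the local density bound `H / 2`, the `4 ^ d` from the ball of a quarter of the radius.
  set K : ℝ := 1 + 2 * C * 4 ^ d / (κ * v) with hK
  have hK1 : 1 ≤ K := by
    have : 0 < 2 * C * 4 ^ d / (κ * v) := by positivity
    linarith
  have hK0 : 0 < K := by linarith
  have hKbig : 2 * C * 4 ^ d / (κ * v) < K ^ (r + d) :=
    lt_of_lt_of_le (by linarith) (Real.self_le_rpow_of_one_le hK1 (by linarith))
  set J : ℝ := min 1 (c / (4 * K) ^ r / 4 / v) with hJ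
  have hJ0 : 0 < J := lt_min one_pos (by positivity)
  have hJ1 : J ≤ 1 := min_le_left _ _
  have hJc : v * J ^ d ≤ c / (4 * K) ^ r / 4 := by
    rw [← le_div_iff₀' hv0]
    exact (pow_le_of_le_one hJ0.le hJ1 hd.ne').trans (min_le_right _ _)
  refine ⟨c / (4 * K) ^ r, 2 * v * K ^ d, J ^ r * (c / (4 * K) ^ r) / 2, 2 * v * K ^ d * K ^ r,
    by positivity, by positivity, by positivity, by positivity,
    fun h hPh α hα x hcont hx a ha => ?_⟩
  obtain ⟨η, hη, hloc⟩ := exists_ball_measure_bounds hPh hcont hx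
  have hH : (0 : ℝ) < h x := by exact_mod_cast hx
  set H : ℝ := (h x : ℝ) with hH_def
  -- Normalised by `H * τ ^ (r + d) = 1`, so the density cancels from the gain at scale `τ * s`, and
  -- `τ ^ (-r)` is the claimed power of `h x`.
  set τ : ℝ := H ^ (-(1 / (r + d))) with hτ_def
  have hτ : 0 < τ := by positivity
  have hτr : τ ^ (-r) = H ^ (r / (r + d)) := by
    rw [hτ_def, ← Real.rpow_mul hH.le]
    congr 1
    ring
  have hHτ' : H * τ ^ (r + d) = 1 := by
    rw [hτ_def, ← Real.rpow_mul hH.le, neg_mul, one_div_mul_cancel hrd.ne', Real.rpow_neg_one,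
      mul_inv_cancel₀ hH.ne']
  have hHτ : H * τ ^ d = τ ^ (-r) := by
    rw [Real.rpow_neg hτ.le]
    refine eq_inv_of_mul_eq_one_left ?_
    rw [← hHτ', Real.rpow_add hτ,
      Real.rpow_natCast]
    ring
  -- Halving `η` keeps the small balls about points `y` near `x` inside the region where the density
  -- is controlled.
  have hshift : ∀ᶠ n : ℕ in atTop, 4 * (K * τ * meshSize d (n + 1)) < η / 2 := by
    have ht : Tendsto (fun n : ℕ => 4 * (K * τ * meshSize d (n + 1))) atTop (nhds 0) := by
      have := (((tendsto_meshSize hd).comp (tendsto_add_atTop_nat 1)).const_mul (K * τ)).const_mul 4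
      simpa using this
    exact ht.eventually_lt_const (by positivity)
  -- Work at stage `n + 1`, so that removing a point gives a competitor for `n`.
  rw [← map_add_atTop_eq_nat 1, eventually_map]
  filter_upwards [hinc α hα, hshift] with n ⟨hfin, hup, hlow⟩ hsmall
  have hs : 0 < meshSize d (n + 1) := meshSize_pos (Nat.le_add_left 1 n)
  set s := meshSize d (n + 1)
  have hρ : 0 < K * τ * s := by positivity
  have hαn := hα (n + 1) (Nat.le_add_left 1 n)
  obtain ⟨han, hxn⟩ := ha (n + 1) (Nat.le_add_left 1 n)
  have hbal : C * s ^ (r + d) <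
      κ * (K * τ * s) ^ r * (H / 2 * ((K * τ * s / 4) ^ d * v)) := by
    have e1 : κ * (K * τ * s) ^ r * (H / 2 * ((K * τ * s / 4) ^ d * v)) =
        K ^ (r + d) * (κ * v) / (2 * 4 ^ d) * s ^ (r + d) := by
      rw [div_pow, mul_pow, mul_pow, Real.mul_rpow (by positivity) hs.le,
        Real.mul_rpow hK0.le hτ.le, Real.rpow_add hs, Real.rpow_add hK0, Real.rpow_natCast,
        Real.rpow_natCast]
      rw [Real.rpow_add hτ, Real.rpow_natCast] at hHτ'
      field_simp
      linear_combination hHτ'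
    rw [e1]
    gcongr
    rw [div_lt_iff₀ (by positivity)] at hKbig
    rw [lt_div_iff₀ (by positivity)]
    linarith
  have hU : ∀ y ∈ Metric.ball x (η / 2),
      Metric.infEDist y (α (n + 1)) < ENNReal.ofReal (K * τ * s) := by
    intro y hy
    have hfin' : quantErrorPow P r (n + 1 + 1) ≠ ∞ :=
      ne_top_of_le_ne_top hfin (quantErrorPow_anti P r (Nat.le_succ _))
    refine infEDist_lt_of_increment_le hr hαn hfin' (H := H / 2) (by positivity) hρ hup
      (hloc _ (fun z hz => ?_) Metric.isClosed_closedBall.measurableSet).1 ?_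
    · rw [Metric.mem_ball] at hy ⊢
      rw [Metric.mem_closedBall] at hz
      have := dist_triangle z y x
      linarith
    · rwa [max_eq_left (by positivity)]
  rw [← hτr]
  exact voronoiCell_bounds hr hαn hfin hc hs hτ hK0 hJ0 (hJ1.trans hK1) hH hHτ hJc hlow hsmall hU
    (fun A hA hAm => (hloc A (hA.trans (Metric.ball_subset_ball (by linarith))) hAm).2) han hxn

end Main

/-- Rewriting a constant backwards with this identity reduces the limit bounds to bounds at each
large `n`. -/
lemma natCast_mul_ofReal_meshSize {d n : ℕ} (hd : 0 < d) (hn : 1 ≤ n) (c : ℝ≥0) (t : ℝ≥0) :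
    (n : ℝ≥0∞) * ENNReal.ofReal (c * (t * meshSize d n ^ d)) = ((c * t : ℝ≥0) : ℝ≥0∞) := by
  have h := natCast_mul_meshSize_pow hd hn
  rw [← ENNReal.ofReal_natCast, ← ENNReal.ofReal_mul (by positivity), ← ENNReal.ofReal_coe_nnreal]
  congr 1
  push_cast
  linear_combination (c * t : ℝ) * h

lemma natCast_rpow_mul_ofReal_meshSize {d n : ℕ} (hd : 0 < d) (hn : 1 ≤ n) (r : ℝ) (c : ℝ≥0) :
    (n : ℝ≥0∞) ^ (1 + r / (d : ℝ)) * ENNReal.ofReal (c * meshSize d n ^ (r + d)) = c := by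
  rw [ENNReal.ofReal_mul c.coe_nonneg, mul_left_comm, natCast_rpow_mul_meshSize_rpow hd hn, mul_one,
    ENNReal.ofReal_coe_nnreal]

theorem corollary5p8
    {E : Type*} [NormedAddCommGroup E] [NormedSpace ℝ E] [FiniteDimensional ℝ E] [Nontrivial E]
    [MeasurableSpace E] [BorelSpace E]
    (lam : Measure E) [lam.IsAddHaarMeasure]
    (P : Measure E) [IsProbabilityMeasure P] (hP : P ≪ lam)
    (r : ℝ) (hr : 0 < r)
    (hmom : ∃ δ : ℝ, 0 < δ ∧ ∫⁻ x, ‖x‖ₑ ^ (r + δ) ∂P < ∞) :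
    -- constants depending only on the normed space, `lam`, `P` and `r`
    ∃ c₁ c₂ c₃ c₄ : ℝ≥0, 0 < c₁ ∧ 0 < c₂ ∧ 0 < c₃ ∧ 0 < c₄ ∧
      -- `h` is a density of `P`, `α n` an `n`-optimal codebook
      ∀ (h : E → ℝ≥0), Measurable h → P = lam.withDensity (fun y => (h y : ℝ≥0∞)) →
      ∀ (α : ℕ → Set E), (∀ n, 1 ≤ n → IsOptimalCodebook P r n (α n)) →
      ∀ (x : E), x ∈ interior P.support → ContinuousAt h x → 0 < h x →
      -- `a n` is the centre of a cell of `α n` that contains `x`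
      ∀ (a : ℕ → E), (∀ n, 1 ≤ n → a n ∈ α n ∧ x ∈ voronoiCell (a n) (α n)) →
        (((c₁ * h x ^ (r / (r + Module.finrank ℝ E)) : ℝ≥0) : ℝ≥0∞)
            ≤ liminf (fun n : ℕ => (n : ℝ≥0∞) * P (openVoronoiCell (a n) (α n))) atTop ∧
          liminf (fun n : ℕ => (n : ℝ≥0∞) * P (openVoronoiCell (a n) (α n))) atTop
            ≤ limsup (fun n : ℕ => (n : ℝ≥0∞) * P (voronoiCell (a n) (α n))) atTop ∧
          limsup (fun n : ℕ => (n : ℝ≥0∞) * P (voronoiCell (a n) (α n))) atTop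
            ≤ ((c₂ * h x ^ (r / (r + Module.finrank ℝ E)) : ℝ≥0) : ℝ≥0∞)) ∧
        ((c₃ : ℝ≥0∞)
            ≤ liminf (fun n : ℕ => (n : ℝ≥0∞) ^ (1 + r / (Module.finrank ℝ E : ℝ)) *
                localInertia P r (a n) (α n)) atTop ∧
          liminf (fun n : ℕ => (n : ℝ≥0∞) ^ (1 + r / (Module.finrank ℝ E : ℝ)) *
                localInertia P r (a n) (α n)) atTop
            ≤ limsup (fun n : ℕ => (n : ℝ≥0∞) ^ (1 + r / (Module.finrank ℝ E : ℝ)) *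
                localInertia P r (a n) (α n)) atTop ∧
          limsup (fun n : ℕ => (n : ℝ≥0∞) ^ (1 + r / (Module.finrank ℝ E : ℝ)) *
                localInertia P r (a n) (α n)) atTop
            ≤ (c₄ : ℝ≥0∞)) := by
  have hd : 0 < Module.finrank ℝ E := Module.finrank_pos
  obtain ⟨c₁, c₂, c₃, c₄, h₁, h₂, h₃, h₄, hmain⟩ :=
    exists_eventually_voronoiCell_bounds lam P hP hr hmom
  lift c₁ to ℝ≥0 using h₁.le
  lift c₂ to ℝ≥0 using h₂.le
  lift c₃ to ℝ≥0 using h₃.le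
  lift c₄ to ℝ≥0 using h₄.le
  refine ⟨c₁, c₂, c₃, c₄, by exact_mod_cast h₁, by exact_mod_cast h₂, by exact_mod_cast h₃,
    by exact_mod_cast h₄, fun h _ hPh α hα x _ hcont hx a ha => ?_⟩
  have hev := (hmain h hPh α hα x hcont hx a ha).and (eventually_ge_atTop 1)
  refine ⟨⟨?_, ?_, ?_⟩, ?_, liminf_le_limsup, ?_⟩
  · refine le_liminf_of_le (by isBoundedDefault) ?_
    filter_upwards [hev] with n ⟨hn, hn1⟩
    rw [← natCast_mul_ofReal_meshSize hd hn1]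
    push_cast
    gcongr
    exact hn.1
  · refine (liminf_le_liminf ?_).trans liminf_le_limsup
    filter_upwards [eventually_ge_atTop 1] with n hn1
    gcongr
    exact openVoronoiCell_subset_voronoiCell (ha n hn1).1
  · refine limsup_le_of_le (by isBoundedDefault) ?_
    filter_upwards [hev] with n ⟨hn, hn1⟩
    rw [← natCast_mul_ofReal_meshSize hd hn1]
    push_cast
    gcongr
    exact hn.2.1
  · refine le_liminf_of_le (by isBoundedDefault) ?_
    filter_upwards [hev] with n ⟨hn, hn1⟩
    rw [← natCast_rpow_mul_ofReal_meshSize hd hn1 r]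
    gcongr
    exact hn.2.2.1
  · refine limsup_le_of_le (by isBoundedDefault) ?_
    filter_upwards [hev] with n ⟨hn, hn1⟩
    rw [← natCast_rpow_mul_ofReal_meshSize hd hn1 r]
    gcongr
    exact hn.2.2.2
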